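/- Let $\beta\in C^1([0,+\infty))$ be strictly increasing with $\beta(0)=0$ and $\beta^\infty:=\lim_{r\to+\infty}\beta(r)<+\infty$; extend $\beta$ continuously to $[0,+\infty]$ by $\beta(+\infty)=\beta^\infty$, and put $\beta^\varepsilon(r)=\beta(r)+\varepsilon r$. Let $V\in C^1(\mathbb R)$ and $V^\varepsilon\in C^1(\mathbb R)$, $\varepsilon>0$, with $(V^\varepsilon)'\to V'$ uniformly on compact sets as $\varepsilon\downarrow0$. For a finite nonnegative Borel measure $\rho$ on $\mathbb R$ let $\rho=\rho^a+\rho^\perp$ be its Lebesgue decomposition with respect to the Lebesgue measure $\mathcal L^1$. A continuous $u:\mathbb R\to[0,+\infty]$, with $D(u)=\{u<+\infty\}$ and $D_>(u)=\{0<u<+\infty\}$, is a *generalized continuous density* of $\rho$ if $\rho^\perp(D(u))=0$, $\mathcal L^1(\mathbb R\setminus D(u))=0$ and $\rho^a=u\,\mathcal L^1|_{D(u)}$; such a $u$ is unique. If $\rho$ has such a density and $\beta\circ u\in W^{1,1}_{\rm loc}(\mathbb R)$, set $$\mathcal I(\rho)=\int_{D_>(u)}\Big|\frac{\partial_x\beta(u)}{u}+V'\Big|^2u\,dx+\int_{\mathbb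 R}|V'|^2\,d\rho^\perp ,$$ and $\mathcal I(\rho)=+\infty$ otherwise. If $\rho=u\mathcal L^1$ with $u\in W^{1,1}_{\rm loc}(\mathbb R)$, set $$\mathcal I^\varepsilon(\rho)=\int_{\mathbb R}\Big|\frac{\partial_x\beta^\varepsilon(u)}{u}+(V^\varepsilon)'\Big|^2u\,dx ,$$ and $\mathcal I^\varepsilon(\rho)=+\infty$ otherwise. Let $\mathfrak m>0$ and, for every $\varepsilon>0$, let $\rho^\varepsilon=u^\varepsilon\mathcal L^1$ be a nonnegative measure of mass $\mathfrak m$ with $u^\varepsilon$ continuous, $u^\varepsilon(x)>0$ for all $x\in\mathbb R$, and $\mathcal I^\varepsilon(\rho^\varepsilon)<+\infty$. Suppose that, as $\varepsilon\downarrow0$, $\rho^\varepsilon\rightharpoonup\rho$ weakly (in duality with bounded continuous functions) for a finite measure $\rho$, and $\limsup_{\varepsilon\downarrow0}\mathcal I^\varepsilon(\rho^\varepsilon)<+\infty$. Then: 1. $\rho$ has mass $\mathfrak m$ and a generalized continuous density $u$, $\beta\circ u\in W^{1,1}_{\rm loc}(\mathbb R)$, $\mathcal I(\rho)<+\infty$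 and $\mathcal I(\rho)\le\liminf_{\varepsilon\downarrow0}\mathcal I^\varepsilon(\rho^\varepsilon)$. If moreover $\liminf_{\varepsilon\downarrow0}\int x^2\,d\rho^\varepsilon<+\infty$, then $\int x^2\,d\rho<+\infty$. 2. $u^\varepsilon\to u$ uniformly on compact subsets of $D(u)$. 3. Let $\xi^\varepsilon=\partial_x\beta^\varepsilon(u^\varepsilon)/u^\varepsilon+(V^\varepsilon)'$, so that $\xi^\varepsilon\rho^\varepsilon=\partial_x\beta^\varepsilon(u^\varepsilon)\mathcal L^1+(V^\varepsilon)'\rho^\varepsilon$. There is $\xi\in L^2(\rho)$ with $\xi\rho=\partial_x\beta(u)\mathcal L^1+V'\rho$ (as functionals on $C^0_c(\mathbb R)$) such that $\xi^\varepsilon\rho^\varepsilon\rightharpoonup\xi\rho$ in duality with $C^0_b(\mathbb R)$. 4. If $f:[0,+\infty)\to\mathbb R$ is continuous and $\lim_{r\to+\infty}f(r)/r=f_\infty\in\mathbb R$, then $f(u)$ (defined a.e.) is locally integrable and $f(u^\varepsilon)\mathcal L^1\rightharpoonup f(u)\mathcal L^1+f_\infty\rho^\perp$ in duality with $C^0_c(\mathbb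 R)$. -/

import Mathlib

open MeasureTheory Filter Topology Set
open scoped ENNReal NNReal ContDiff

/-- `g` is the weak (distributional) derivative of `w` on the real line, both functions being
locally integrable. -/
structure IsWeakDeriv (w g : ℝ → ℝ) : Prop where
  locInt : LocallyIntegrable w volume
  locInt_deriv : LocallyIntegrable g volume
  integral_eq : ∀ ζ : ℝ → ℝ, ContDiff ℝ ∞ ζ → HasCompactSupport ζ →
    ∫ x, deriv ζ x * w x = - ∫ x, ζ x * g x

/-- The weak derivative is unique up to a Lebesgue null set. -/
theorem IsWeakDeriv.ae_eq {w g h : ℝ → ℝ} (hg : IsWeakDeriv w g) (hh : IsWeakDeriv w h) :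
    g =ᵐ[volume] h := by
  refine ae_eq_of_integral_contDiff_smul_eq hg.locInt_deriv hh.locInt_deriv ?_
  intro ζ hζ hc
  have h1 := hg.integral_eq ζ hζ hc
  have h2 := hh.integral_eq ζ hζ hc
  simp only [smul_eq_mul]
  linarith

/-- `w ∈ W^{1,1}_loc(ℝ)`. -/
def MemW11loc (w : ℝ → ℝ) : Prop := ∃ g, IsWeakDeriv w g

open Classical in
/-- The weak derivative of `w` (determined almost everywhere); zero if there is none. -/
noncomputable def weakDeriv (w : ℝ → ℝ) : ℝ → ℝ :=
  if h : MemW11loc w then h.choose else 0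

theorem MemW11loc.isWeakDeriv {w : ℝ → ℝ} (h : MemW11loc w) : IsWeakDeriv w (weakDeriv w) := by
  rw [weakDeriv, dif_pos h]
  exact h.choose_spec

/-- The set where an extended density is finite. -/
def properDomain (u : ℝ → ℝ≥0∞) : Set ℝ := {x | u x < ⊤}

/-- The set where an extended density is finite and positive. -/
def positiveDomain (u : ℝ → ℝ≥0∞) : Set ℝ := {x | 0 < u x ∧ u x < ⊤}

/-- `u ∈ C⁰(ℝ; [0,+∞])` is a generalized continuous density of `ρ`: the singular part of `ρ` does
not charge the set where `u` is finite, the complement of that set is Lebesgue null, and the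
absolutely continuous part of `ρ` has density `u` there. -/
structure IsGenContDensity (ρ : Measure ℝ) (u : ℝ → ℝ≥0∞) : Prop where
  continuous : Continuous u
  singularPart_eq : ρ.singularPart volume (properDomain u) = 0
  volume_compl : volume (properDomain u)ᶜ = 0
  acPart_eq : volume.withDensity (ρ.rnDeriv volume)
    = (volume.restrict (properDomain u)).withDensity u

/-- The generalized continuous density is unique. -/
theorem IsGenContDensity.unique {ρ : Measure ℝ} [IsFiniteMeasure ρ] {u v : ℝ → ℝ≥0∞}
    (hu : IsGenContDensity ρ u) (hv : IsGenContDensity ρ v) : u = v := by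
  have key : ∀ {w : ℝ → ℝ≥0∞}, IsGenContDensity ρ w → w =ᵐ[volume] ρ.rnDeriv volume := by
    intro w hw
    have h1 : volume.restrict (properDomain w) = volume := by
      rw [Measure.restrict_eq_self_of_ae_mem]
      exact mem_ae_iff.2 hw.volume_compl
    have h2 := hw.acPart_eq
    rw [h1] at h2
    have := (withDensity_eq_iff_of_sigmaFinite (μ := volume)
      (Measure.measurable_rnDeriv ρ volume).aemeasurable hw.continuous.measurable.aemeasurable).1 h2
    exact this.symm
  exact (hu.continuous.ae_eq_iff_eq volume hv.continuous).1 ((key hu).trans (key hv).symm)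

/-- The continuous extension of `β : [0,+∞) → ℝ` to `[0,+∞]`, where `βinf = lim β(r)` as
`r → +∞`. -/
noncomputable def extBeta (β : ℝ → ℝ) (βinf : ℝ) (r : ℝ≥0∞) : ℝ :=
  if r = ⊤ then βinf else β r.toReal

/-- `∫_{0<u<∞} |∂ₓβ(u)/u + V'|² u dx + ∫ |V'|² dρ^⊥`. -/
noncomputable def fisherIntegral (β : ℝ → ℝ) (βinf : ℝ) (V : ℝ → ℝ) (ρ : Measure ℝ)
    (u : ℝ → ℝ≥0∞) : ℝ≥0∞ :=
  (∫⁻ x in positiveDomain u,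
    ENNReal.ofReal ((weakDeriv (fun y => extBeta β βinf (u y)) x / (u x).toReal + deriv V x) ^ 2)
      * u x)
  + ∫⁻ x, ENNReal.ofReal (deriv V x ^ 2) ∂(ρ.singularPart volume)

open Classical in
/-- The generalized Fisher dissipation `I(ρ)`: it is `+∞` unless `ρ` has a (unique) generalized
continuous density `u` with `β ∘ u ∈ W^{1,1}_loc(ℝ)`. -/
noncomputable def genFisher (β : ℝ → ℝ) (βinf : ℝ) (V : ℝ → ℝ) (ρ : Measure ℝ) : ℝ≥0∞ :=
  if h : ∃ u, IsGenContDensity ρ u ∧ MemW11loc (fun x => extBeta β βinf (u x)) then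
    fisherIntegral β βinf V ρ h.choose
  else ⊤

/-- `I(ρ)` is computed with the generalized continuous density of `ρ`. -/
theorem genFisher_eq (β : ℝ → ℝ) (βinf : ℝ) (V : ℝ → ℝ) {ρ : Measure ℝ} [IsFiniteMeasure ρ]
    {u : ℝ → ℝ≥0∞} (hu : IsGenContDensity ρ u)
    (hw : MemW11loc (fun x => extBeta β βinf (u x))) :
    genFisher β βinf V ρ = fisherIntegral β βinf V ρ u := by
  have h : ∃ u, IsGenContDensity ρ u ∧ MemW11loc (fun x => extBeta β βinf (u x)) := ⟨u, hu, hw⟩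
  rw [genFisher, dif_pos h, h.choose_spec.1.unique hu]

/-- The viscous nonlinearity `β^ε(r) = β(r) + ε r`. -/
def viscousBeta (β : ℝ → ℝ) (ε r : ℝ) : ℝ := β r + ε * r

/-- The vector field `∂ₓβ^ε(u)/u + W'`, for a positive density `u`; multiplied by `u` it is the
viscous flux `∂ₓβ^ε(u) + W' u`. -/
noncomputable def viscousField (β : ℝ → ℝ) (ε : ℝ) (W : ℝ → ℝ) (u : ℝ → ℝ) (x : ℝ) : ℝ :=
  weakDeriv (fun y => viscousBeta β ε (u y)) x / u x + deriv W x

open Classical in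
/-- The viscous Fisher dissipation `I^ε(ρ) = ∫ |∂ₓβ^ε(u)/u + W'|² u dx` if `ρ = u dx` with
`u ∈ W^{1,1}_loc(ℝ)`, and `+∞` otherwise. -/
noncomputable def viscousFisher (β : ℝ → ℝ) (ε : ℝ) (W : ℝ → ℝ) (ρ : Measure ℝ) : ℝ≥0∞ :=
  if ρ ≪ volume ∧ MemW11loc (fun x => (ρ.rnDeriv volume x).toReal) then
    ∫⁻ x, ENNReal.ofReal (viscousField β ε W (fun y => (ρ.rnDeriv volume y).toReal) x ^ 2)
      * ρ.rnDeriv volume x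
  else ⊤

/-! The bound on the dissipation says that the fields `ξ^ε` are bounded in `L²(ρ^ε)`, and the flux
identity `∂ₓβ^ε(u^ε) = (ξ^ε - (V^ε)') u^ε` turns this into control of the oscillation of `β(u^ε)`.
Where `u^ε ≤ M`, Young's inequality bounds the increment of `β(u^ε)` by the energy plus a multiple
of the length of the interval. Where `u^ε > M`, `β(u^ε)` lies within `βinf - β M` of its supremum.
Hence `β ∘ u^ε` is asymptotically locally equicontinuous (`IsViscousFamily.equicontinuous`). The
extension of `β` embeds the compact space `[0,+∞]` in `ℝ`, so the densities themselves converge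
locally uniformly as `[0,+∞]`-valued functions along every ultrafilter.

The limit `u` is identified with two weights that remain continuous at `+∞`. For `ε > 0` one has
`(1+u^ε)⁻¹ ρ^ε = (1 - (1+u^ε)⁻¹) ℒ¹`, and both sides pass to the limit. On `{u = +∞}` the limit
identity makes Lebesgue measure vanish; on `{u < +∞}` it can be divided by the weight and gives `ρ =
u ℒ¹` (`IsGenContDensity.of_withDensity_damping`). Uniqueness of the density removes the dependence
on the ultrafilter.

Weak limits of the fluxes are represented by some `ξ ∈ L²(ρ)` by Hilbert space duality. The weak
formulation of the flux identity already fixes their values on smooth test functions, so `ξ` is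
unique, and an ultrafilter along which the dissipation is close to its liminf bounds the energy of
`ξ`. The chain rule also passes to the limit for `p ∘ β`. Choosing `p` with `p' = 1 - (s/βinf)^k`,
which tends to `1` below `βinf` and vanishes at `βinf`, separates `{u < +∞}` from `{u = +∞}`
(`setIntegral_flux`): on the former the flux is `∂ₓβ(u) + V'u`, on the latter `ξ = V'`. So the
energy of `ξ` is exactly the limit dissipation.

For asymptotically linear `f`, the linear part is handled by the weak convergence of `ρ^ε`, and the
sublinear remainder can be frozen at a large value with an error uniform in `ε`. -/

/-! ### Weak derivatives on the line -/

/-- A locally absolutely continuous function is weakly differentiable, and its weak derivative is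
its pointwise derivative. -/
theorem isWeakDeriv_of_absolutelyContinuous {w g : ℝ → ℝ} (hwc : Continuous w)
    (hw : ∀ R, AbsolutelyContinuousOnInterval w (-R) R)
    (hg : LocallyIntegrable g volume) (h : ∀ᵐ x, deriv w x = g x) : IsWeakDeriv w g := by
  refine ⟨hwc.locallyIntegrable, hg, fun ζ hζ hc => ?_⟩
  obtain ⟨R, hR⟩ := hc.isCompact.isBounded.subset_ball 0
  rw [Real.ball_eq_Ioo, zero_sub, zero_add] at hR
  have hs : ∀ f : ℝ → ℝ, Function.support f ⊆ tsupport ζ →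
      ∫ x in (-R)..R, f x = ∫ x, f x := fun f hf =>
    intervalIntegral.integral_eq_integral_of_support_subset
      ((hf.trans hR).trans Ioo_subset_Ioc_self)
  have hout : ∀ x, x ∉ Ioo (-R) R → ζ x = 0 := fun x hx =>
    image_eq_zero_of_notMem_tsupport fun h => hx (hR h)
  have key := (hζ.of_le (by exact_mod_cast le_top) : ContDiff ℝ 1 ζ).contDiffOn
    |>.absolutelyContinuousOnInterval.integral_mul_deriv_eq_deriv_mul (hw R)
  rw [hout R (by simp), hout (-R) (by simp)] at key
  rw [hs _ ((Function.support_mul_subset_left _ _).trans (subset_tsupport _)),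
    hs _ ((Function.support_mul_subset_left _ _).trans (support_deriv_subset))] at key
  have : ∫ x, ζ x * deriv w x = ∫ x, ζ x * g x :=
    integral_congr_ae (h.mono fun x hx => by simp only [hx])
  linarith

/-- Du Bois-Reymond lemma: a function with vanishing weak derivative is constant. -/
theorem exists_ae_eq_const_of_integral_deriv_mul_eq_zero {h : ℝ → ℝ}
    (hh : LocallyIntegrable h volume)
    (h0 : ∀ ζ : ℝ → ℝ, ContDiff ℝ ∞ ζ → HasCompactSupport ζ → ∫ x, deriv ζ x * h x = 0) :
    ∃ c : ℝ, h =ᵐ[volume] fun _ => c := by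
  let b : ContDiffBump (0 : ℝ) := ⟨1, 2, by norm_num, by norm_num⟩
  set ψ : ℝ → ℝ := b.normed volume with hψ
  have hψs : ContDiff ℝ ∞ ψ := b.contDiff_normed
  have hψc : HasCompactSupport ψ := b.hasCompactSupport_normed
  have hψi : ∫ x, ψ x = 1 := b.integral_normed
  have hint : ∀ φ : ℝ → ℝ, ContDiff ℝ ∞ φ → HasCompactSupport φ →
      Integrable (fun x => φ x * h x) volume := fun φ hφ hc =>
    hh.integrable_smul_left_of_hasCompactSupport hφ.continuous hc
  refine ⟨∫ x, ψ x * h x, ?_⟩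
  refine ae_eq_of_integral_contDiff_smul_eq hh continuous_const.locallyIntegrable ?_
  intro φ hφ hφc
  set a := ∫ x, φ x
  -- Removing the mass of `φ` makes the primitive of `η` compactly supported, hence an admissible
  -- test function.
  set η : ℝ → ℝ := fun x => φ x - a * ψ x with hη
  have hηs : ContDiff ℝ ∞ η := hφ.sub (contDiff_const.mul hψs)
  have hηc : HasCompactSupport η := hφc.sub hψc.mul_left
  have hηi : ∫ x, η x = 0 := by
    rw [integral_sub (hφ.continuous.integrable_of_hasCompactSupport hφc)
      ((hψs.continuous.integrable_of_hasCompactSupport hψc).const_mul a), integral_const_mul, hψi]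
    simp [a]
  obtain ⟨R, hR⟩ := hηc.isCompact.isBounded.subset_ball 0
  rw [Real.ball_eq_Ioo, zero_sub, zero_add] at hR
  have hout : ∀ x, x ∉ Ioo (-R) R → η x = 0 := fun x hx =>
    image_eq_zero_of_notMem_tsupport fun h => hx (hR h)
  set ζ : ℝ → ℝ := fun x => ∫ t in (-R)..x, η t with hζ
  have hd : ∀ x, HasDerivAt ζ (η x) x := fun x =>
    intervalIntegral.integral_hasDerivAt_right (hηs.continuous.intervalIntegrable _ _)
      (hηs.continuous.stronglyMeasurableAtFilter _ _) hηs.continuous.continuousAt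
  have hdζ : deriv ζ = η := funext fun x => (hd x).deriv
  have hζs : ContDiff ℝ ∞ ζ :=
    contDiff_infty_iff_deriv.2 ⟨fun x => (hd x).differentiableAt, hdζ ▸ hηs⟩
  have hζc : HasCompactSupport ζ := by
    refine HasCompactSupport.intro (isCompact_Icc (a := -R) (b := R)) fun x hx => ?_
    rcases lt_or_ge x (-R) with h1 | h1
    · refine (intervalIntegral.integral_congr (g := fun _ => 0) fun t ht => ?_).trans (by simp)
      exact hout t fun h2 => by
        rw [uIcc_of_ge h1.le] at ht
        linarith [ht.2, h2.1]
    · have h2 : R < x := by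
        by_contra h3
        exact hx ⟨h1, not_lt.1 h3⟩
      rw [← hηi]
      refine intervalIntegral.integral_eq_integral_of_support_subset fun t ht => ?_
      have := hR (subset_tsupport _ ht)
      exact ⟨this.1, this.2.le.trans h2.le⟩
  have := h0 ζ hζs hζc
  rw [hdζ] at this
  simp only [hη, sub_mul] at this
  rw [integral_sub (hint φ hφ hφc) (by simpa [mul_assoc] using (hint ψ hψs hψc).const_mul a)] at this
  simp only [mul_assoc, integral_const_mul] at this
  simp only [smul_eq_mul, integral_mul_const]
  linarith

theorem IsWeakDeriv.congr {w w' g g' : ℝ → ℝ} (h : IsWeakDeriv w g) (hw : w =ᵐ[volume] w')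
    (hg : g =ᵐ[volume] g') : IsWeakDeriv w' g' := by
  refine ⟨h.locInt.congr hw, h.locInt_deriv.congr hg, fun ζ hζ hc => ?_⟩
  have h1 : ∫ x, deriv ζ x * w x = ∫ x, deriv ζ x * w' x :=
    integral_congr_ae (hw.mono fun x hx => by simp only [hx])
  have h2 : ∫ x, ζ x * g x = ∫ x, ζ x * g' x :=
    integral_congr_ae (hg.mono fun x hx => by simp only [hx])
  rw [← h1, ← h2]
  exact h.integral_eq ζ hζ hc

theorem IsWeakDeriv.weakDeriv_ae_eq {w g : ℝ → ℝ} (h : IsWeakDeriv w g) :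
    weakDeriv w =ᵐ[volume] g :=
  (MemW11loc.isWeakDeriv ⟨g, h⟩).ae_eq h

theorem MeasureTheory.LocallyIntegrable.intervalIntegrable_real {g : ℝ → ℝ}
    (hg : LocallyIntegrable g volume) (a b : ℝ) : IntervalIntegrable g volume a b :=
  intervalIntegrable_iff.2 ((hg.integrableOn_isCompact isCompact_uIcc).mono_set uIoc_subset_uIcc)

theorem LipschitzOnWith.comp_absolutelyContinuousOnInterval {F u : ℝ → ℝ} {K : ℝ≥0} {s : Set ℝ}
    {a b : ℝ} (hF : LipschitzOnWith K F s) (hu : AbsolutelyContinuousOnInterval u a b)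
    (hs : MapsTo u (uIcc a b) s) : AbsolutelyContinuousOnInterval (fun x => F (u x)) a b := by
  have h0 := Tendsto.const_mul (K : ℝ) hu
  rw [mul_zero] at h0
  refine squeeze_zero' (Eventually.of_forall fun _ => Finset.sum_nonneg fun _ _ => dist_nonneg)
    ?_ h0
  refine eventually_inf_principal.2 (Eventually.of_forall fun E hE => ?_)
  rw [Finset.mul_sum]
  exact Finset.sum_le_sum fun i hi =>
    hF.dist_le_mul _ (hs (hE.1 i hi).1) _ (hs (hE.1 i hi).2)

theorem MeasureTheory.LocallyIntegrable.absolutelyContinuousOnInterval_integral {g : ℝ → ℝ}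
    (hg : LocallyIntegrable g volume) {R : ℝ} (hR : 0 ≤ R) :
    AbsolutelyContinuousOnInterval (fun x => ∫ t in (0 : ℝ)..x, g t) (-R) R :=
  (hg.intervalIntegrable_real (-R) R).absolutelyContinuousOnInterval_intervalIntegral
    (by rw [uIcc_of_le (by linarith)]; exact ⟨by linarith, hR⟩)

theorem AbsolutelyContinuousOnInterval.of_nonneg {w : ℝ → ℝ}
    (hw : ∀ R, 0 ≤ R → AbsolutelyContinuousOnInterval w (-R) R) (R : ℝ) :
    AbsolutelyContinuousOnInterval w (-R) R := by
  rcases le_total 0 R with h | h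
  · exact hw R h
  · have := (hw (-R) (by linarith)).symm
    rwa [neg_neg] at this

/-- The fundamental theorem of calculus for continuous weakly differentiable functions. -/
theorem IsWeakDeriv.eq_add_integral {w g : ℝ → ℝ} (h : IsWeakDeriv w g) (hw : Continuous w)
    (x : ℝ) : w x = w 0 + ∫ t in (0 : ℝ)..x, g t := by
  have hG : Continuous fun x => ∫ t in (0 : ℝ)..x, g t :=
    intervalIntegral.continuous_primitive (fun a b => h.locInt_deriv.intervalIntegrable_real a b) 0
  have hGd : IsWeakDeriv (fun x => ∫ t in (0 : ℝ)..x, g t) g :=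
    isWeakDeriv_of_absolutelyContinuous hG (AbsolutelyContinuousOnInterval.of_nonneg fun R hR =>
      h.locInt_deriv.absolutelyContinuousOnInterval_integral hR) h.locInt_deriv
      ((LocallyIntegrable.ae_hasDerivAt_integral h.locInt_deriv).mono fun x hx => (hx 0).deriv)
  have hint : ∀ f : ℝ → ℝ, LocallyIntegrable f volume → ∀ φ : ℝ → ℝ, Continuous φ →
      HasCompactSupport φ → Integrable (fun x => φ x * f x) volume := fun f hf φ hφ hc =>
    hf.integrable_smul_left_of_hasCompactSupport hφ hc
  obtain ⟨c, hc⟩ := exists_ae_eq_const_of_integral_deriv_mul_eq_zero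
    (h := fun x => w x - ∫ t in (0 : ℝ)..x, g t) (hw.sub hG).locallyIntegrable (by
      intro ζ hζ hζc
      simp only [mul_sub]
      rw [integral_sub
        (hint _ h.locInt _ (hζ.continuous_deriv (by exact_mod_cast le_top)) hζc.deriv)
        (hint _ hGd.locInt _ (hζ.continuous_deriv (by exact_mod_cast le_top)) hζc.deriv),
        h.integral_eq ζ hζ hζc, hGd.integral_eq ζ hζ hζc, sub_self])
  have hc' := ((hw.sub hG).ae_eq_iff_eq volume continuous_const).1 hc
  have h0 : w 0 - ∫ t in (0 : ℝ)..0, g t = c := congrFun hc' 0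
  have hx : w x - ∫ t in (0 : ℝ)..x, g t = c := congrFun hc' x
  rw [intervalIntegral.integral_same] at h0
  linarith

theorem IsWeakDeriv.sub_eq_integral {w g : ℝ → ℝ} (h : IsWeakDeriv w g) (hw : Continuous w)
    (x y : ℝ) : w y - w x = ∫ t in x..y, g t := by
  rw [h.eq_add_integral hw x, h.eq_add_integral hw y,
    ← intervalIntegral.integral_interval_sub_left (a := 0) (b := y) (c := x)
      (h.locInt_deriv.intervalIntegrable_real _ _) (h.locInt_deriv.intervalIntegrable_real _ _)]
  ring

/-- The chain rule for positive continuous weakly differentiable functions. -/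
theorem IsWeakDeriv.comp_pos {u g F F' : ℝ → ℝ} (h : IsWeakDeriv u g) (hu : Continuous u)
    (hpos : ∀ x, 0 < u x) (hF : ∀ r, 0 < r → HasDerivAt F (F' r) r)
    (hF' : ContinuousOn F' (Ioi 0)) :
    IsWeakDeriv (fun x => F (u x)) (fun x => F' (u x) * g x) := by
  have hFu : Continuous fun x => F (u x) := by
    rw [continuous_iff_continuousAt]
    exact fun x => (hF _ (hpos x)).continuousAt.comp hu.continuousAt
  have hFu' : Continuous fun x => F' (u x) :=
    hF'.comp_continuous hu hpos
  have hac : ∀ R, AbsolutelyContinuousOnInterval u (-R) R :=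
    AbsolutelyContinuousOnInterval.of_nonneg fun R hR => by
      have := h.locInt_deriv.absolutelyContinuousOnInterval_integral hR
      have h2 : AbsolutelyContinuousOnInterval (fun _ => u 0) (-R) R :=
        contDiffOn_const.absolutelyContinuousOnInterval
      have h3 := h2.add this
      rwa [show (fun _ => u 0) + (fun x => ∫ t in (0 : ℝ)..x, g t) = u from
        funext fun x => (h.eq_add_integral hu x).symm] at h3
  refine isWeakDeriv_of_absolutelyContinuous hFu (fun R => ?_)
    (h.locInt_deriv.continuous_mul hFu') ?_
  -- `F` is controlled only on `(0,+∞)`; on a bounded interval `u` takes values in a compact subset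
  -- of it, where `F` is Lipschitz.
  · obtain ⟨a, ha, ha'⟩ := isCompact_uIcc.exists_isMinOn (nonempty_uIcc (a := -R) (b := R))
      hu.continuousOn
    obtain ⟨b, hb, hb'⟩ := isCompact_uIcc.exists_isMaxOn (nonempty_uIcc (a := -R) (b := R))
      hu.continuousOn
    have hsub : Icc (u a) (u b) ⊆ Ioi 0 := fun r hr => (hpos a).trans_le hr.1
    obtain ⟨C, hC⟩ := isCompact_Icc.exists_bound_of_continuousOn (hF'.mono hsub)
    have hL : LipschitzOnWith C.toNNReal F (Icc (u a) (u b)) :=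
      (convex_Icc _ _).lipschitzOnWith_of_nnnorm_hasDerivWithin_le
        (fun r hr => (hF r (hsub hr)).hasDerivWithinAt)
        (fun r hr => by
          rw [← NNReal.coe_le_coe, coe_nnnorm]
          exact (hC r hr).trans (Real.le_coe_toNNReal C))
    exact hL.comp_absolutelyContinuousOnInterval (hac R) fun x hx => ⟨ha' hx, hb' hx⟩
  · filter_upwards [LocallyIntegrable.ae_hasDerivAt_integral h.locInt_deriv] with x hx
    have h1 : HasDerivAt u (g x) x := by
      have := (hx 0).const_add (u 0)
      exact this.congr_of_eventuallyEq (Eventually.of_forall fun y => h.eq_add_integral hu y)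
    exact ((hF _ (hpos x)).comp x h1).deriv

/-! ### States of the viscous problem and their fields -/

/-- A finite measure with a positive continuous density and finite viscous Fisher dissipation,
for a nondecreasing nonlinearity which is continuously differentiable on `(0,+∞)`. -/
structure IsViscousState (β : ℝ → ℝ) (ε : ℝ) (W : ℝ → ℝ) (μ : Measure ℝ) (u : ℝ → ℝ) : Prop where
  hasDerivAt : ∀ r, 0 < r → HasDerivAt β (deriv β r) r
  deriv_nonneg : ∀ r, 0 < r → 0 ≤ deriv β r
  continuousOn_deriv : ContinuousOn (deriv β) (Ioi 0)
  eps_pos : 0 < ε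
  continuous_deriv_potential : Continuous (deriv W)
  continuous : Continuous u
  pos : ∀ x, 0 < u x
  eq_withDensity : μ = volume.withDensity fun x => ENNReal.ofReal (u x)
  fisher_lt_top : viscousFisher β ε W μ < ⊤

namespace IsViscousState

variable {β W u : ℝ → ℝ} {ε : ℝ} {μ : Measure ℝ}

theorem absolutelyContinuous (h : IsViscousState β ε W μ u) : μ ≪ volume := by
  rw [h.eq_withDensity]
  exact withDensity_absolutelyContinuous _ _

theorem measurable_ofReal (h : IsViscousState β ε W μ u) :
    Measurable fun x => ENNReal.ofReal (u x) :=
  h.continuous.measurable.ennreal_ofReal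

theorem rnDeriv_ae_eq (h : IsViscousState β ε W μ u) :
    μ.rnDeriv volume =ᵐ[volume] fun x => ENNReal.ofReal (u x) := by
  rw [h.eq_withDensity]
  exact Measure.rnDeriv_withDensity _ h.measurable_ofReal

theorem toReal_rnDeriv_ae_eq (h : IsViscousState β ε W μ u) :
    (fun x => (μ.rnDeriv volume x).toReal) =ᵐ[volume] u :=
  h.rnDeriv_ae_eq.mono fun x hx => by
    simp only [hx, ENNReal.toReal_ofReal (h.pos x).le]

theorem integral_eq (h : IsViscousState β ε W μ u) (f : ℝ → ℝ) :
    ∫ x, f x ∂μ = ∫ x, f x * u x := by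
  rw [h.eq_withDensity, integral_withDensity_eq_integral_toReal_smul h.measurable_ofReal
    (Eventually.of_forall fun x => ENNReal.ofReal_lt_top)]
  refine integral_congr_ae (Eventually.of_forall fun x => ?_)
  simp only [ENNReal.toReal_ofReal (h.pos x).le, smul_eq_mul, mul_comm]

theorem integrable_iff (h : IsViscousState β ε W μ u) {f : ℝ → ℝ} :
    Integrable f μ ↔ Integrable (fun x => f x * u x) volume := by
  rw [h.eq_withDensity, integrable_withDensity_iff h.measurable_ofReal
    (Eventually.of_forall fun x => ENNReal.ofReal_lt_top)]
  simp only [ENNReal.toReal_ofReal (h.pos _).le]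

theorem fisher_conditions (h : IsViscousState β ε W μ u) :
    μ ≪ volume ∧ MemW11loc (fun x => (μ.rnDeriv volume x).toReal) := by
  by_contra hc
  have := h.fisher_lt_top
  rw [viscousFisher, if_neg hc] at this
  exact lt_irrefl _ this

theorem exists_isWeakDeriv (h : IsViscousState β ε W μ u) : ∃ g, IsWeakDeriv u g := by
  obtain ⟨g, hg⟩ := h.fisher_conditions.2
  exact ⟨g, hg.congr h.toReal_rnDeriv_ae_eq (ae_eq_refl g)⟩

theorem isWeakDeriv_viscousBeta (h : IsViscousState β ε W μ u) {g : ℝ → ℝ}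
    (hg : IsWeakDeriv u g) :
    IsWeakDeriv (fun x => viscousBeta β ε (u x)) (fun x => (deriv β (u x) + ε) * g x) := by
  refine hg.comp_pos (F' := fun r => deriv β r + ε) h.continuous h.pos (fun r hr => ?_)
    (h.continuousOn_deriv.add continuousOn_const)
  have := (h.hasDerivAt r hr).add ((hasDerivAt_id r).const_mul ε)
  rwa [mul_one] at this

/-- The flux identity `u ξ = ∂ₓβ^ε(u) + W' u`. -/
theorem field_ae_eq (h : IsViscousState β ε W μ u) {g : ℝ → ℝ} (hg : IsWeakDeriv u g) :
    ∀ᵐ x, u x * (viscousField β ε W u x - deriv W x) = (deriv β (u x) + ε) * g x := by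
  filter_upwards [(h.isWeakDeriv_viscousBeta hg).weakDeriv_ae_eq] with x hx
  rw [viscousField, hx, add_sub_cancel_right, mul_div_cancel₀ _ (h.pos x).ne']

theorem aestronglyMeasurable_field (h : IsViscousState β ε W μ u) :
    AEStronglyMeasurable (viscousField β ε W u) μ := by
  obtain ⟨g, hg⟩ := h.exists_isWeakDeriv
  have h1 := (MemW11loc.isWeakDeriv
    ⟨_, h.isWeakDeriv_viscousBeta hg⟩).locInt_deriv.aestronglyMeasurable
  have h2 : AEStronglyMeasurable (viscousField β ε W u) volume :=
    (h1.aemeasurable.div h.continuous.measurable.aemeasurable).aestronglyMeasurable.add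
      h.continuous_deriv_potential.aestronglyMeasurable
  exact h2.mono_ac h.absolutelyContinuous

/-- The dissipation is defined through the Radon–Nikodym derivative and the field through the
continuous density. The two densities agree almost everywhere, hence so do the weak derivatives. -/
theorem lintegral_field_sq (h : IsViscousState β ε W μ u) :
    ∫⁻ x, ENNReal.ofReal (viscousField β ε W u x ^ 2) ∂μ = viscousFisher β ε W μ := by
  obtain ⟨g, hg⟩ := h.exists_isWeakDeriv
  have h0 := h.isWeakDeriv_viscousBeta hg
  have h1 : IsWeakDeriv (fun x => viscousBeta β ε ((μ.rnDeriv volume x).toReal))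
      (fun x => (deriv β (u x) + ε) * g x) :=
    h0.congr (h.toReal_rnDeriv_ae_eq.mono fun x hx => by simp only [hx]) (ae_eq_refl _)
  rw [viscousFisher, if_pos h.fisher_conditions]
  conv_lhs => rw [h.eq_withDensity]
  rw [lintegral_withDensity_eq_lintegral_mul_non_measurable _ h.measurable_ofReal
    (Eventually.of_forall fun x => ENNReal.ofReal_lt_top)]
  refine lintegral_congr_ae ?_
  filter_upwards [h.rnDeriv_ae_eq, h.toReal_rnDeriv_ae_eq, h0.weakDeriv_ae_eq,
    h1.weakDeriv_ae_eq] with x hx1 hx2 hx3 hx4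
  simp only [Pi.mul_apply, viscousField, hx1, hx3, hx4,
    ENNReal.toReal_ofReal (h.pos x).le, mul_comm]

theorem memLp_field (h : IsViscousState β ε W μ u) : MemLp (viscousField β ε W u) 2 μ := by
  refine ⟨h.aestronglyMeasurable_field, ?_⟩
  rw [eLpNorm_lt_top_iff_lintegral_rpow_enorm_lt_top (by norm_num) (by norm_num)]
  refine lt_of_eq_of_lt ?_ h.fisher_lt_top
  rw [← h.lintegral_field_sq]
  refine lintegral_congr fun x => ?_
  rw [Real.enorm_eq_ofReal_abs, ENNReal.ofReal_rpow_of_nonneg (abs_nonneg _) (by norm_num)]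
  simp

/-- Weak differentiation of functions of the density, in terms of the field. -/
theorem isWeakDeriv_comp (h : IsViscousState β ε W μ u) {F θ : ℝ → ℝ}
    (hF : ∀ r, 0 < r → HasDerivAt F (θ r * (deriv β r + ε)) r) (hθ : ContinuousOn θ (Ioi 0)) :
    IsWeakDeriv (fun x => F (u x))
      (fun x => θ (u x) * (viscousField β ε W u x - deriv W x) * u x) := by
  obtain ⟨g, hg⟩ := h.exists_isWeakDeriv
  refine (hg.comp_pos h.continuous h.pos hF
    (hθ.mul (h.continuousOn_deriv.add continuousOn_const))).congr (ae_eq_refl _) ?_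
  filter_upwards [h.field_ae_eq hg] with x hx
  rw [mul_assoc, ← hx]
  ring

/-- Writing `F' = θ (β' + ε)` lets the flux identity eliminate the derivative of `u`. Only the field
remains on the right, and it is controlled in `L²(μ)`. -/
theorem integral_deriv_mul_comp (h : IsViscousState β ε W μ u) {F θ : ℝ → ℝ}
    (hF : ∀ r, 0 < r → HasDerivAt F (θ r * (deriv β r + ε)) r) (hθ : ContinuousOn θ (Ioi 0))
    {ζ : ℝ → ℝ} (hζ : ContDiff ℝ ∞ ζ) (hc : HasCompactSupport ζ) :
    ∫ x, deriv ζ x * F (u x)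
      = - ∫ x, ζ x * (θ (u x) * (viscousField β ε W u x - deriv W x)) ∂μ := by
  rw [(h.isWeakDeriv_comp hF hθ).integral_eq ζ hζ hc, h.integral_eq]
  simp only [mul_assoc]

end IsViscousState

/-! ### Weak compactness of fields over varying measures -/

/-- The quadratic polynomial `t ↦ ∫ (t f + g)²` is nonnegative, so its discriminant is nonpositive.
-/
theorem sq_integral_mul_le {α : Type*} [MeasurableSpace α] {μ : Measure α} {f g : α → ℝ}
    (hf : MemLp f 2 μ) (hg : MemLp g 2 μ) :
    (∫ x, f x * g x ∂μ) ^ 2 ≤ (∫ x, f x ^ 2 ∂μ) * ∫ x, g x ^ 2 ∂μ := by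
  have hfg : Integrable (fun x => f x * g x) μ := hf.integrable_mul hg
  have key : ∀ t : ℝ, 0 ≤ (∫ x, f x ^ 2 ∂μ) * (t * t) + (2 * ∫ x, f x * g x ∂μ) * t
      + ∫ x, g x ^ 2 ∂μ := fun t => by
    have h0 : 0 ≤ ∫ x, (t * f x + g x) ^ 2 ∂μ := integral_nonneg fun x => sq_nonneg _
    have h1 : ∀ x, (t * f x + g x) ^ 2 = t * t * f x ^ 2 + 2 * t * (f x * g x) + g x ^ 2 :=
      fun x => by ring
    simp only [h1] at h0
    have h2 : Integrable (fun x => t * t * f x ^ 2 + 2 * t * (f x * g x)) μ :=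
      (hf.integrable_sq.const_mul _).add (hfg.const_mul _)
    rw [integral_add h2 hg.integrable_sq, integral_add (hf.integrable_sq.const_mul _) (hfg.const_mul _), integral_const_mul,
      integral_const_mul] at h0
    linarith
  have := discrim_le_zero key
  rw [discrim] at this
  nlinarith

/-- A linear functional which is bounded by the Hilbert norm of a linear map factors through the
inner product with a vector. -/
theorem exists_inner_eq_of_abs_le_norm {E H : Type*} [AddCommGroup E] [Module ℝ E]
    [NormedAddCommGroup H] [InnerProductSpace ℝ H] [CompleteSpace H] (T : E →ₗ[ℝ] H)
    (L : E →ₗ[ℝ] ℝ) {c : ℝ} (hc : 0 ≤ c) (hL : ∀ e, |L e| ≤ c * ‖T e‖) :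
    ∃ h : H, ‖h‖ ≤ c ∧ ∀ e, L e = inner ℝ h (T e) := by
  -- The linear section `s` need not be continuous: `L` vanishes on the kernel of `T`, so `L ∘ s`
  -- does not depend on the choice, and the bound on `L` makes it continuous. The range need not be
  -- closed, hence the extension by Hahn–Banach.
  obtain ⟨s, hs⟩ := T.rangeRestrict.exists_rightInverse_of_surjective T.range_rangeRestrict
  have hTs : ∀ y : LinearMap.range T, T (s y) = y := fun y =>
    congrArg Subtype.val (LinearMap.congr_fun hs y)
  let f : LinearMap.range T →L[ℝ] ℝ := (L ∘ₗ s).mkContinuous c fun y => by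
    simpa [hTs] using hL (s y)
  have hf : ‖f‖ ≤ c := LinearMap.mkContinuous_norm_le _ hc _
  obtain ⟨g, hg, hgn⟩ := exists_extension_norm_eq (LinearMap.range T) f
  refine ⟨(InnerProductSpace.toDual ℝ H).symm g, ?_, fun e => ?_⟩
  · rw [LinearIsometryEquiv.norm_map, hgn]
    exact hf
  · rw [InnerProductSpace.toDual_symm_apply]
    have h1 : g (T e) = f (T.rangeRestrict e) := hg (T.rangeRestrict e)
    have h2 : L (e - s (T.rangeRestrict e)) = 0 := by
      have := hL (e - s (T.rangeRestrict e))
      rw [map_sub T, hTs] at this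
      simpa using this
    rw [map_sub, sub_eq_zero] at h2
    rw [h2]
    exact h1.symm

/-- Weak compactness of vector fields with bounded energy along an ultrafilter. -/
theorem exists_weak_limit_of_energy_le {ι : Type*} (l : Ultrafilter ι)
    {μs : ι → FiniteMeasure ℝ} {μ : FiniteMeasure ℝ} (hμ : Tendsto μs l (𝓝 μ))
    {ξs : ι → ℝ → ℝ} {c : ℝ} (hc : 0 ≤ c)
    (hξ : ∀ᶠ i in l, MemLp (ξs i) 2 (μs i : Measure ℝ) ∧
      ∫ x, ξs i x ^ 2 ∂(μs i : Measure ℝ) ≤ c) :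
    ∃ ξ : ℝ → ℝ, MemLp ξ 2 (μ : Measure ℝ) ∧ ∫ x, ξ x ^ 2 ∂(μ : Measure ℝ) ≤ c ∧
      ∀ φ : BoundedContinuousFunction ℝ ℝ,
        Tendsto (fun i => ∫ x, φ x * ξs i x ∂(μs i : Measure ℝ)) l
          (𝓝 (∫ x, φ x * ξ x ∂(μ : Measure ℝ))) := by
  rw [FiniteMeasure.tendsto_iff_forall_integral_tendsto] at hμ
  have hφ2 : ∀ (φ : BoundedContinuousFunction ℝ ℝ) (ν : FiniteMeasure ℝ),
      MemLp φ 2 (ν : Measure ℝ) := fun φ ν =>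
    MemLp.of_bound φ.continuous.aestronglyMeasurable ‖φ‖ (Eventually.of_forall φ.norm_coe_le_norm)
  have hcs : ∀ φ : BoundedContinuousFunction ℝ ℝ, ∀ᶠ i in l,
      (∫ x, φ x * ξs i x ∂(μs i : Measure ℝ)) ^ 2 ≤ (∫ x, φ x ^ 2 ∂(μs i : Measure ℝ)) * c :=
    fun φ => hξ.mono fun i hi => (sq_integral_mul_le (hφ2 φ _) hi.1).trans
      (mul_le_mul_of_nonneg_left hi.2 (integral_nonneg fun x => sq_nonneg _))
  have hsq : ∀ φ : BoundedContinuousFunction ℝ ℝ,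
      Tendsto (fun i => (∫ x, φ x ^ 2 ∂(μs i : Measure ℝ)) * c) l
        (𝓝 ((∫ x, φ x ^ 2 ∂(μ : Measure ℝ)) * c)) := fun φ => by
    have := (hμ (φ ^ 2)).mul_const c
    simpa using this
  have hlim : ∀ φ : BoundedContinuousFunction ℝ ℝ, ∃ a,
      Tendsto (fun i => ∫ x, φ x * ξs i x ∂(μs i : Measure ℝ)) l (𝓝 a) := fun φ => by
    -- By Cauchy–Schwarz the pairings eventually stay in a compact interval, so they converge along
    -- the ultrafilter.
    set B := (∫ x, φ x ^ 2 ∂(μ : Measure ℝ)) * c + 1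
    have hB : ∀ᶠ i in l, (∫ x, φ x * ξs i x ∂(μs i : Measure ℝ)) ∈ Icc (-√B) √B := by
      filter_upwards [hcs φ, (hsq φ).eventually_lt_const (lt_add_one _)] with i h1 h2
      exact abs_le.1 (Real.abs_le_sqrt (h1.trans h2.le))
    obtain ⟨a, -, ha⟩ := isCompact_Icc.ultrafilter_le_nhds
      (l.map fun i => ∫ x, φ x * ξs i x ∂(μs i : Measure ℝ)) (le_principal_iff.2 hB)
    exact ⟨a, ha⟩
  choose Λ hΛ using hlim
  have hint : ∀ φ : BoundedContinuousFunction ℝ ℝ, ∀ᶠ i in l,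
      Integrable (fun x => φ x * ξs i x) (μs i : Measure ℝ) := fun φ =>
    hξ.mono fun i hi => (hφ2 φ _).integrable_mul hi.1
  let L : BoundedContinuousFunction ℝ ℝ →ₗ[ℝ] ℝ :=
    { toFun := Λ
      map_add' := fun φ ψ => by
        refine tendsto_nhds_unique (hΛ (φ + ψ)) (((hΛ φ).add (hΛ ψ)).congr' ?_)
        filter_upwards [hint φ, hint ψ] with i h1 h2
        rw [← integral_add h1 h2]
        simp only [BoundedContinuousFunction.coe_add, Pi.add_apply, add_mul]
      map_smul' := fun a φ => by
        refine tendsto_nhds_unique (hΛ (a • φ)) (((hΛ φ).const_mul a).congr' ?_)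
        refine Eventually.of_forall fun i => ?_
        dsimp only
        rw [← integral_const_mul]
        simp only [BoundedContinuousFunction.coe_smul, smul_eq_mul, mul_assoc] }
  let T : BoundedContinuousFunction ℝ ℝ →L[ℝ] Lp ℝ 2 (μ : Measure ℝ) :=
    BoundedContinuousFunction.toLp 2 (μ : Measure ℝ) ℝ
  have hT : ∀ φ, T φ =ᵐ[(μ : Measure ℝ)] φ := fun φ => BoundedContinuousFunction.coeFn_toLp (𝕜 := ℝ) 2 (μ : Measure ℝ) φ
  have hTn : ∀ f : Lp ℝ 2 (μ : Measure ℝ), ‖f‖ ^ 2 = ∫ x, f x ^ 2 ∂(μ : Measure ℝ) := fun f => by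
    rw [← real_inner_self_eq_norm_sq, L2.inner_def]
    exact integral_congr_ae (Eventually.of_forall fun x => by simp)
  -- The limit of the Cauchy–Schwarz inequalities bounds the functional by the norm of `L²(μ)`,
  -- although each pairing was taken in a different space.
  have hLT : ∀ φ, |L φ| ≤ √c * ‖T.toLinearMap φ‖ := fun φ => by
    have h1 : Λ φ ^ 2 ≤ (∫ x, φ x ^ 2 ∂(μ : Measure ℝ)) * c :=
      le_of_tendsto_of_tendsto ((hΛ φ).pow 2) (hsq φ) (hcs φ)
    have h2 : ‖T φ‖ ^ 2 = ∫ x, φ x ^ 2 ∂(μ : Measure ℝ) := by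
      rw [hTn]
      exact integral_congr_ae ((hT φ).mono fun x hx => by simp only [hx])
    refine abs_le_of_sq_le_sq ?_ (by positivity)
    rw [mul_pow, Real.sq_sqrt hc]
    change Λ φ ^ 2 ≤ c * ‖T φ‖ ^ 2
    rw [h2, mul_comm]
    exact h1
  obtain ⟨ξ, hξn, hξL⟩ := exists_inner_eq_of_abs_le_norm T.toLinearMap L (Real.sqrt_nonneg c) hLT
  refine ⟨ξ, Lp.memLp ξ, ?_, fun φ => ?_⟩
  · rw [← hTn, ← Real.sq_sqrt hc]
    gcongr
  · have h1 : ∫ x, φ x * ξ x ∂(μ : Measure ℝ) = L φ := by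
      rw [hξL, L2.inner_def]
      refine integral_congr_ae ((hT φ).mono fun x hx => ?_)
      change φ x * ξ x = inner ℝ (ξ x) (T φ x)
      rw [hx]
      simp
    rw [h1]
    exact hΛ φ

/-! ### Continuous convergence and passage to the limit in integrals -/

/-- Continuous convergence: joint convergence in the index and in the point. -/
def TendstoContinuously {ι X Y : Type*} [TopologicalSpace X] [TopologicalSpace Y]
    (f : ι → X → Y) (l : Filter ι) (F : X → Y) : Prop :=
  ∀ x, Tendsto (fun p : ι × X => f p.1 p.2) (l ×ˢ 𝓝 x) (𝓝 (F x))

namespace TendstoContinuously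

variable {ι X Y Z : Type*} [TopologicalSpace X] [TopologicalSpace Y] [TopologicalSpace Z]
  {f : ι → X → Y} {l : Filter ι} {F : X → Y}

theorem tendsto (h : TendstoContinuously f l F) (x : X) :
    Tendsto (fun i => f i x) l (𝓝 (F x)) :=
  (h x).comp (tendsto_id.prodMk (tendsto_const_nhds (x := x)))

theorem comp_continuous (h : TendstoContinuously f l F) {g : Y → Z} (hg : Continuous g) :
    TendstoContinuously (fun i x => g (f i x)) l (fun x => g (F x)) := fun x =>
  (hg.tendsto _).comp (h x)

/-- The functions `f i` themselves need not be continuous: a closed neighbourhood of `F x` that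
contains `f i y` for all late `i` and all `y` near `x` also contains `F y`. -/
theorem continuous [RegularSpace Y] [l.NeBot] (h : TendstoContinuously f l F) :
    Continuous F := by
  rw [continuous_iff_continuousAt]
  intro x
  rw [ContinuousAt, (closed_nhds_basis (F x)).tendsto_right_iff]
  rintro C ⟨hC, hCc⟩
  obtain ⟨p, hp, q, hq, hpq⟩ := eventually_prod_iff.1 ((h x).eventually hC)
  exact hq.mono fun y hy => hCc.mem_of_tendsto (h.tendsto y) (hp.mono fun i hi => hpq hi hy)

end TendstoContinuously

/-- Everything is required only at points of `K`, so that it applies to the real densities on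
compact sets where the limit is finite. -/
theorem tendstoUniformlyOn_of_tendsto_prod {ι X : Type*} [TopologicalSpace X]
    {f : ι → X → ℝ} {l : Filter ι} {F : X → ℝ} {K : Set X} (hK : IsCompact K)
    (hF : ∀ x ∈ K, ContinuousAt F x)
    (h : ∀ x ∈ K, Tendsto (fun p : ι × X => f p.1 p.2) (l ×ˢ 𝓝 x) (𝓝 (F x))) :
    TendstoUniformlyOn f F l K := by
  rw [← tendstoLocallyUniformlyOn_iff_tendstoUniformlyOn_of_compact hK,
    Metric.tendstoLocallyUniformlyOn_iff]
  intro η hη x hx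
  obtain ⟨p, hp, q, hq, hpq⟩ :=
    eventually_prod_iff.1 ((h x hx).eventually (Metric.ball_mem_nhds _ (half_pos hη)))
  have hF' := (hF x hx).eventually (Metric.ball_mem_nhds _ (half_pos hη))
  refine ⟨{y | q y ∧ F y ∈ Metric.ball (F x) (η / 2)},
    nhdsWithin_le_nhds (hq.and hF'), hp.mono fun i hi y hy => ?_⟩
  have h1 := hpq hi hy.1
  have h2 := hy.2
  rw [Metric.mem_ball] at h2
  change dist (f i y) (F x) < η / 2 at h1
  have := dist_triangle_right (F y) (f i y) (F x)
  linarith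

theorem TendstoContinuously.tendstoUniformlyOn {ι X : Type*} [TopologicalSpace X]
    {f : ι → X → ℝ} {l : Filter ι} [l.NeBot] {F : X → ℝ} (h : TendstoContinuously f l F)
    {K : Set X} (hK : IsCompact K) : TendstoUniformlyOn f F l K :=
  tendstoUniformlyOn_of_tendsto_prod hK (fun _ _ => h.continuous.continuousAt) fun x _ => h x

/-- A pointwise convergent, locally equicontinuous family converges continuously. -/
theorem tendstoContinuously_of_equicontinuous {ι : Type*} {f : ι → ℝ → ℝ} {l : Filter ι}
    {F : ℝ → ℝ} (hF : ∀ x, Tendsto (fun i => f i x) l (𝓝 (F x)))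
    (heq : ∀ x, ∀ η > 0, ∃ δ > 0, ∀ᶠ i in l, ∀ y, |y - x| < δ → |f i y - f i x| ≤ η) :
    TendstoContinuously f l F := by
  intro x
  rw [Metric.tendsto_nhds]
  intro η hη
  obtain ⟨δ, hδ, h⟩ := heq x (η / 2) (half_pos hη)
  filter_upwards [((hF x).eventually (Metric.ball_mem_nhds _ (half_pos hη))).prod_mk
    (Metric.ball_mem_nhds x hδ), h.prod_inl (𝓝 x)] with p h1 h2
  have h3 := h2 p.2 (by simpa [Real.dist_eq] using h1.2)
  have h4 := h1.1
  rw [Real.dist_eq] at h4 ⊢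
  have := abs_sub_le (f p.1 p.2) (f p.1 x) (F x)
  linarith

/-- In integrals against a bounded family of densities, a test function may be multiplied by
a locally uniformly convergent family. -/
theorem tendsto_integral_mul_of_tendstoUniformlyOn {ι : Type*} {l : Filter ι}
    {ν : ι → Measure ℝ} {h : ι → ℝ → ℝ} {c : ℝ}
    (hh : ∀ᶠ i in l, Integrable (h i) (ν i) ∧ ∫ x, |h i x| ∂(ν i) ≤ c)
    {φ : ℝ → ℝ} (hφ : Continuous φ) (hφc : HasCompactSupport φ)
    {g : ι → ℝ → ℝ} {G : ℝ → ℝ} (hg : ∀ᶠ i in l, Continuous (g i)) (hG : Continuous G)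
    (hgG : TendstoUniformlyOn g G l (tsupport φ)) {a : ℝ}
    (ha : Tendsto (fun i => ∫ x, φ x * G x * h i x ∂(ν i)) l (𝓝 a)) :
    Tendsto (fun i => ∫ x, φ x * g i x * h i x ∂(ν i)) l (𝓝 a) := by
  obtain ⟨M, hM⟩ := hφc.exists_bound_of_continuous hφ
  have hM0 : 0 ≤ M := (norm_nonneg _).trans (hM 0)
  have hint : ∀ {i} {k : ℝ → ℝ}, Integrable (h i) (ν i) → Continuous k →
      Integrable (fun x => φ x * k x * h i x) (ν i) := fun {i k} hi hk => by
    obtain ⟨B, hB⟩ := (hφc.mul_right (f' := k)).exists_bound_of_continuous (hφ.mul hk)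
    exact hi.bdd_mul (hφ.mul hk).aestronglyMeasurable (Eventually.of_forall hB)
  have hdiff : Tendsto (fun i => (∫ x, φ x * g i x * h i x ∂(ν i))
      - ∫ x, φ x * G x * h i x ∂(ν i)) l (𝓝 0) := by
    rw [Metric.tendsto_nhds]
    intro η hη
    have hpos : 0 < M * |c| + 1 := by positivity
    filter_upwards [hh, hg, Metric.tendstoUniformlyOn_iff.1 hgG (η / (M * |c| + 1))
      (by positivity)] with i hi hgi hu
    rw [dist_zero_right, ← integral_sub (hint hi.1 hgi) (hint hi.1 hG)]
    have hb : ∀ x, ‖φ x * g i x * h i x - φ x * G x * h i x‖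
        ≤ M * (η / (M * |c| + 1)) * |h i x| := fun x => by
      rw [← sub_mul, ← mul_sub, norm_mul, norm_mul, Real.norm_eq_abs (h i x)]
      refine mul_le_mul_of_nonneg_right ?_ (abs_nonneg _)
      by_cases hx : x ∈ tsupport φ
      · refine mul_le_mul (hM x) ?_ (norm_nonneg _) hM0
        rw [← dist_eq_norm, dist_comm]
        exact (hu x hx).le
      · rw [image_eq_zero_of_notMem_tsupport hx, norm_zero, zero_mul]
        positivity
    calc ‖∫ x, φ x * g i x * h i x - φ x * G x * h i x ∂(ν i)‖
        ≤ ∫ x, M * (η / (M * |c| + 1)) * |h i x| ∂(ν i) :=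
          norm_integral_le_of_norm_le (hi.1.abs.const_mul _) (Eventually.of_forall hb)
      _ = M * (η / (M * |c| + 1)) * ∫ x, |h i x| ∂(ν i) := integral_const_mul _ _
      _ ≤ M * (η / (M * |c| + 1)) * |c| := by
          gcongr
          exact hi.2.trans (le_abs_self c)
      _ = η * (M * |c| / (M * |c| + 1)) := by ring
      _ < η * 1 := by
          gcongr
          rw [div_lt_one hpos]
          linarith
      _ = η := mul_one η
  simpa using hdiff.add ha

theorem TendstoContinuously.tendsto_integral_volume {ι : Type*} {l : Filter ι} [l.NeBot]
    {g : ι → ℝ → ℝ} {G : ℝ → ℝ} (h : TendstoContinuously g l G)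
    (hg : ∀ᶠ i in l, Continuous (g i)) {φ : ℝ → ℝ} (hφ : Continuous φ)
    (hφc : HasCompactSupport φ) :
    Tendsto (fun i => ∫ x, φ x * g i x) l (𝓝 (∫ x, φ x * G x)) := by
  -- Lebesgue measure is infinite; restricted to the support of `φ` it is finite and the constant
  -- `1` is an admissible density.
  have hres : ∀ k : ℝ → ℝ,
      ∫ x, φ x * k x = ∫ x, φ x * k x * 1 ∂(volume.restrict (tsupport φ)) := fun k => by
    simp only [mul_one]
    refine (setIntegral_eq_integral_of_forall_compl_eq_zero fun x hx => ?_).symm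
    rw [image_eq_zero_of_notMem_tsupport hx, zero_mul]
  have hfin : IsFiniteMeasure (volume.restrict (tsupport φ)) :=
    ⟨by simpa using hφc.isCompact.measure_lt_top⟩
  simp only [hres]
  exact tendsto_integral_mul_of_tendstoUniformlyOn
    (ν := fun _ => volume.restrict (tsupport φ)) (h := fun _ _ => 1)
    (c := ∫ _, |(1 : ℝ)| ∂(volume.restrict (tsupport φ)))
    (Eventually.of_forall fun _ => ⟨integrable_const _, le_rfl⟩) hφ hφc hg h.continuous
    (h.tendstoUniformlyOn hφc.isCompact) tendsto_const_nhds

theorem integrable_bounded_mul {μ : Measure ℝ} {φ h : ℝ → ℝ} (hφ : Continuous φ)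
    {C : ℝ} (hC : ∀ x, |φ x| ≤ C) (hh : Integrable h μ) :
    Integrable (fun x => φ x * h x) μ :=
  hh.bdd_mul hφ.aestronglyMeasurable (Eventually.of_forall hC)

theorem FiniteMeasure.tendsto_integral_mul_of_tendstoUniformlyOn {ι : Type*} {l : Filter ι}
    {μs : ι → FiniteMeasure ℝ} {μ : FiniteMeasure ℝ}
    (hμ : Tendsto μs l (𝓝 μ)) {φ : ℝ → ℝ} (hφ : Continuous φ) (hφc : HasCompactSupport φ)
    {g : ι → ℝ → ℝ} {G : ℝ → ℝ} (hg : ∀ᶠ i in l, Continuous (g i)) (hG : Continuous G)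
    (hgG : TendstoUniformlyOn g G l (tsupport φ)) :
    Tendsto (fun i => ∫ x, φ x * g i x ∂(μs i : Measure ℝ)) l
      (𝓝 (∫ x, φ x * G x ∂(μ : Measure ℝ))) := by
  obtain ⟨B, hB⟩ := (hφc.mul_right (f' := G)).exists_bound_of_continuous (hφ.mul hG)
  have h0 := FiniteMeasure.tendsto_iff_forall_integral_tendsto.1 hμ
    (BoundedContinuousFunction.ofNormedAddCommGroup (fun x => φ x * G x) (hφ.mul hG) B hB)
  have hm := ((FiniteMeasure.continuous_mass.tendsto μ).comp hμ).eventually_le_const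
    (lt_add_one μ.mass)
  have := _root_.tendsto_integral_mul_of_tendstoUniformlyOn (l := l)
    (ν := fun i => (μs i : Measure ℝ))
    (h := fun _ _ => 1) (c := (μ.mass + 1 : ℝ≥0)) ?_ hφ hφc hg hG hgG
    (a := ∫ x, φ x * G x ∂(μ : Measure ℝ)) (by simpa using h0)
  · simpa using this
  · filter_upwards [hm] with i hi
    refine ⟨integrable_const _, ?_⟩
    simp only [abs_one, integral_const, smul_eq_mul, mul_one]
    exact_mod_cast hi

/-! ### Saturating nonlinearities and their extension to `[0,+∞]` -/

/-- A continuous strictly increasing nonlinearity on `[0,+∞)` with a finite limit at infinity. -/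
structure IsSaturating (β : ℝ → ℝ) (βinf : ℝ) : Prop where
  continuousOn : ContinuousOn β (Ici 0)
  strictMonoOn : StrictMonoOn β (Ici 0)
  zero : β 0 = 0
  tendsto : Tendsto β atTop (𝓝 βinf)

namespace IsSaturating

variable {β : ℝ → ℝ} {βinf : ℝ}

theorem lt_limit (h : IsSaturating β βinf) {r : ℝ} (hr : 0 ≤ r) : β r < βinf := by
  have h1 : β r < β (r + 1) := h.strictMonoOn hr (by simp; linarith) (by linarith)
  refine h1.trans_le (ge_of_tendsto h.tendsto ?_)
  filter_upwards [eventually_ge_atTop (r + 1)] with s hs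
  exact h.strictMonoOn.monotoneOn (by simp; linarith) (by simp; linarith) hs

theorem nonneg (h : IsSaturating β βinf) {r : ℝ} (hr : 0 ≤ r) : 0 ≤ β r := by
  rw [← h.zero]
  exact h.strictMonoOn.monotoneOn (by simp) hr hr

theorem limit_pos (h : IsSaturating β βinf) : 0 < βinf := by
  rw [← h.zero]
  exact h.lt_limit le_rfl

theorem extBeta_top : extBeta β βinf ⊤ = βinf := if_pos rfl

theorem extBeta_of_ne_top {r : ℝ≥0∞} (hr : r ≠ ⊤) : extBeta β βinf r = β r.toReal := if_neg hr

theorem extBeta_ofReal {r : ℝ} (hr : 0 ≤ r) : extBeta β βinf (ENNReal.ofReal r) = β r := by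
  rw [extBeta_of_ne_top ENNReal.ofReal_ne_top, ENNReal.toReal_ofReal hr]

theorem extBeta_nonneg (h : IsSaturating β βinf) (r : ℝ≥0∞) : 0 ≤ extBeta β βinf r := by
  rw [extBeta]
  split_ifs
  · exact h.limit_pos.le
  · exact h.nonneg ENNReal.toReal_nonneg

theorem extBeta_le (h : IsSaturating β βinf) (r : ℝ≥0∞) : extBeta β βinf r ≤ βinf := by
  rw [extBeta]
  split_ifs
  · exact le_rfl
  · exact (h.lt_limit ENNReal.toReal_nonneg).le

theorem extBeta_lt (h : IsSaturating β βinf) {r : ℝ≥0∞} (hr : r ≠ ⊤) :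
    extBeta β βinf r < βinf := by
  rw [extBeta_of_ne_top hr]
  exact h.lt_limit ENNReal.toReal_nonneg

theorem extBeta_strictMono (h : IsSaturating β βinf) : StrictMono (extBeta β βinf) := by
  intro r s hrs
  have hr : r ≠ ⊤ := (hrs.trans_le le_top).ne
  by_cases hs : s = ⊤
  · rw [hs, extBeta_top]
    exact h.extBeta_lt hr
  · rw [extBeta_of_ne_top hr, extBeta_of_ne_top hs]
    exact h.strictMonoOn ENNReal.toReal_nonneg ENNReal.toReal_nonneg
      ((ENNReal.toReal_lt_toReal hr hs).2 hrs)

theorem continuous_extBeta (h : IsSaturating β βinf) : Continuous (extBeta β βinf) := by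
  rw [continuous_iff_continuousAt]
  intro r
  by_cases hr : r = ⊤
  · rw [hr, ContinuousAt, extBeta_top, ENNReal.nhds_top_basis.tendsto_iff Metric.nhds_basis_ball]
    intro η hη
    obtain ⟨R, hR⟩ := (h.tendsto.eventually (Metric.ball_mem_nhds _ hη)).exists_forall_of_atTop
    refine ⟨ENNReal.ofReal R, ENNReal.ofReal_lt_top, fun s hs => ?_⟩
    by_cases hst : s = ⊤
    · rw [hst, extBeta_top]
      exact Metric.mem_ball_self hη
    · rw [extBeta_of_ne_top hst]
      exact hR _ (le_of_not_gt fun hlt => not_lt.2 ((ENNReal.le_ofReal_iff_toReal_le hst (ENNReal.toReal_nonneg.trans hlt.le)).2 hlt.le) hs)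
  · have h1 : ContinuousAt (fun s : ℝ≥0∞ => β s.toReal) r := by
      refine Tendsto.comp (h.continuousOn r.toReal ENNReal.toReal_nonneg)
        (tendsto_nhdsWithin_iff.2 ⟨ENNReal.tendsto_toReal hr, Eventually.of_forall fun s => ?_⟩)
      exact ENNReal.toReal_nonneg
    refine h1.congr ?_
    filter_upwards [isOpen_ne.mem_nhds hr] with s hs
    exact (extBeta_of_ne_top hs).symm

/-- A continuous injection of the compact space `[0,+∞]` into `ℝ`. It allows convergence of
densities, infinite values included, to be tested after applying the extended nonlinearity. -/
theorem isClosedEmbedding_extBeta (h : IsSaturating β βinf) :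
    IsClosedEmbedding (extBeta β βinf) :=
  h.continuous_extBeta.isClosedEmbedding h.extBeta_strictMono.injective

end IsSaturating

/-! ### Oscillation estimates -/

namespace IsViscousState

variable {β W u : ℝ → ℝ} {ε : ℝ} {μ : Measure ℝ}

/-- Oscillation estimate on an interval where the density is bounded. -/
theorem abs_sub_le_of_le (h : IsViscousState β ε W μ u) {c L M a x y : ℝ} (ha : 0 < a)
    (hL : 0 ≤ L) (hc : ∫ t, viscousField β ε W u t ^ 2 ∂μ ≤ c)
    (hW : ∀ t ∈ uIcc x y, |deriv W t| ≤ L) (hM : ∀ t ∈ uIcc x y, u t ≤ M) :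
    |β (u y) - β (u x)| ≤ a * c + (1 / a + L) * M * |y - x| := by
  have hpos : ∀ r, 0 < r → 0 < deriv β r + ε := fun r hr =>
    add_pos_of_nonneg_of_pos (h.deriv_nonneg r hr) h.eps_pos
  set ξ := viscousField β ε W u with hξ
  -- With `θ = β'/(β' + ε)` the viscous part disappears at the cost of a factor in `[0,1]`, so the
  -- estimate is uniform in `ε`.
  have hwd := h.isWeakDeriv_comp (F := β) (θ := fun r => deriv β r / (deriv β r + ε))
    (fun r hr => by
      rw [div_mul_cancel₀ _ (hpos r hr).ne']
      exact h.hasDerivAt r hr)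
    (h.continuousOn_deriv.div (h.continuousOn_deriv.add continuousOn_const)
      fun r hr => (hpos r hr).ne')
  have hcont : Continuous fun x => β (u x) := by
    rw [continuous_iff_continuousAt]
    exact fun x => (h.hasDerivAt _ (h.pos x)).continuousAt.comp h.continuous.continuousAt
  rw [hwd.sub_eq_integral hcont x y]
  have hsq : Integrable (fun t => ξ t ^ 2 * u t) volume :=
    h.integrable_iff.1 h.memLp_field.integrable_sq
  have hsq_nonneg : ∀ t, 0 ≤ ξ t ^ 2 * u t := fun t => mul_nonneg (sq_nonneg _) (h.pos t).le
  have hbound : ∀ t ∈ uIoc x y,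
      ‖deriv β (u t) / (deriv β (u t) + ε) * (ξ t - deriv W t) * u t‖
        ≤ a * (ξ t ^ 2 * u t) + (1 / a + L) * M := fun t ht => by
    have ht' := uIoc_subset_uIcc ht
    have h1 : |deriv β (u t) / (deriv β (u t) + ε)| ≤ 1 := by
      rw [abs_of_nonneg (div_nonneg (h.deriv_nonneg _ (h.pos t)) (hpos _ (h.pos t)).le),
        div_le_one (hpos _ (h.pos t))]
      linarith [h.eps_pos]
    -- Young's inequality: multiplied by `u t`, the first term is paid for by the energy, the second
    -- by `u ≤ M` and the length of the interval.
    have h2 : |ξ t| ≤ a * ξ t ^ 2 + 1 / a := by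
      have h3 : a * |ξ t| ≤ a ^ 2 * |ξ t| ^ 2 + 1 := by nlinarith [sq_nonneg (a * |ξ t| - 1)]
      rw [← sq_abs (ξ t)]
      have h4 : a * (a * |ξ t| ^ 2 + 1 / a) = a ^ 2 * |ξ t| ^ 2 + 1 := by field_simp
      rw [← h4] at h3
      exact le_of_mul_le_mul_left h3 ha
    have h3 : |ξ t - deriv W t| ≤ a * ξ t ^ 2 + (1 / a + L) :=
      (abs_sub _ _).trans (by linarith [hW t ht'])
    have h4 : 0 ≤ 1 / a + L := by positivity
    rw [norm_mul, norm_mul, Real.norm_eq_abs, Real.norm_eq_abs, Real.norm_eq_abs,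
      abs_of_pos (h.pos t)]
    calc _ ≤ 1 * (a * ξ t ^ 2 + (1 / a + L)) * u t := by gcongr; exact (h.pos t).le
      _ = a * (ξ t ^ 2 * u t) + (1 / a + L) * u t := by ring
      _ ≤ _ := by gcongr; exact hM t ht'
  have hint : IntegrableOn (fun t => a * (ξ t ^ 2 * u t) + (1 / a + L) * M) (uIoc x y) volume :=
    (hsq.const_mul a).integrableOn.add (integrableOn_const (by simp))
  rw [← Real.norm_eq_abs, intervalIntegral.norm_intervalIntegral_eq]
  refine (norm_integral_le_of_norm_le hint
    ((ae_restrict_iff' measurableSet_uIoc).2 (Eventually.of_forall hbound))).trans ?_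
  rw [integral_add (hsq.const_mul a).integrableOn (integrableOn_const (by simp)),
    integral_const_mul]
  have h5 : ∫ t in uIoc x y, ξ t ^ 2 * u t ≤ c := by
    refine le_trans ?_ hc
    rw [h.integral_eq]
    exact setIntegral_le_integral hsq (Eventually.of_forall hsq_nonneg)
  have h6 : ∫ _ in uIoc x y, (1 / a + L) * M = (1 / a + L) * M * |y - x| := by
    simp [Measure.real, mul_comm]
  rw [h6]
  gcongr

/-- Oscillation estimate: where the density is large the nonlinearity is almost saturated. -/
theorem abs_sub_le (h : IsViscousState β ε W μ u) {βinf : ℝ} (hβ : IsSaturating β βinf)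
    {c L M a x y : ℝ} (ha : 0 < a) (hL : 0 ≤ L) (hM : 0 < M)
    (hc : ∫ t, viscousField β ε W u t ^ 2 ∂μ ≤ c) (hW : ∀ t ∈ uIcc x y, |deriv W t| ≤ L) :
    |β (u y) - β (u x)| ≤ a * c + (1 / a + L) * M * |y - x| + (βinf - β M) := by
  have hc0 : 0 ≤ c := (integral_nonneg fun t => sq_nonneg _).trans hc
  have hsat : 0 ≤ βinf - β M := sub_nonneg.2 (hβ.lt_limit hM.le).le
  suffices key : ∀ x y : ℝ, (∀ t ∈ uIcc x y, |deriv W t| ≤ L) →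
      β (u y) - β (u x) ≤ a * c + (1 / a + L) * M * |y - x| + (βinf - β M) by
    rw [_root_.abs_sub_le_iff]
    refine ⟨key x y hW, ?_⟩
    rw [abs_sub_comm]
    exact key y x (by rwa [uIcc_comm])
  intro x y hW
  by_cases hall : ∀ t ∈ uIcc x y, u t ≤ M
  · have := (le_abs_self _).trans (h.abs_sub_le_of_le ha hL hc hW hall)
    linarith
  push Not at hall
  obtain ⟨t, ht, htM⟩ := hall
  have hy := hβ.lt_limit (h.pos y).le
  have hp : 0 ≤ a * c + (1 / a + L) * M * |y - x| := by positivity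
  -- If `u x ≥ M`, the increment is at most what is left between `β M` and saturation.
  rcases le_or_gt M (u x) with hx | hx
  · have := hβ.strictMonoOn.monotoneOn hM.le (h.pos x).le hx
    linarith
  have hivt : ∀ s, M < u s → ∃ z ∈ uIcc x s, u z = M := fun s hs =>
    intermediate_value_uIcc h.continuous.continuousOn
      (by rw [uIcc_of_le (hx.trans hs).le]; exact ⟨hx.le, hs.le⟩)
  have hcomp : IsCompact {z | z ∈ uIcc x y ∧ u z = M} :=
    isCompact_uIcc.inter_right (isClosed_eq h.continuous continuous_const)
  obtain ⟨z₀, hz₀, hz₀M⟩ := hivt t htM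
  -- `z` is the point of the level set `{u = M}` nearest to `x`. The path from `x` to `z` is covered
  -- by the previous estimate, and from `β (u z) = β M` to `β (u y)` only the saturation gap can be
  -- gained.
  obtain ⟨z, hz, hmin⟩ := hcomp.exists_isMinOn
    ⟨z₀, uIcc_subset_uIcc_left ht hz₀, hz₀M⟩ (f := fun z => |z - x|) (by fun_prop)
  have hzM : ∀ s ∈ uIcc x z, u s ≤ M := by
    intro s hs
    by_contra hsM
    obtain ⟨s', hs', hs'M⟩ := hivt s (not_le.1 hsM)
    have h1 : |z - x| ≤ |s' - x| := hmin ⟨uIcc_subset_uIcc_left hz.1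
      (uIcc_subset_uIcc_left hs hs'), hs'M⟩
    have h2 : |s' - x| ≤ |s - x| := abs_sub_left_of_mem_uIcc hs'
    -- A point before `z` where `u > M` would be preceded by a crossing `s'` of level `M`; since no
    -- crossing is nearer to `x` than `z`, this forces `s' = s`.
    have h3 : s' = s := by
      rcases le_total x z with hxz | hxz
      · rw [uIcc_of_le hxz] at hs
        rw [uIcc_of_le hs.1] at hs'
        rw [abs_of_nonneg (by linarith), abs_of_nonneg (by linarith [hs'.1])] at h1
        linarith [hs'.2, hs.2]
      · rw [uIcc_of_ge hxz] at hs
        rw [uIcc_of_ge hs.2] at hs'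
        rw [abs_of_nonpos (by linarith), abs_of_nonpos (by linarith [hs'.2])] at h1
        linarith [hs'.1, hs.1]
    rw [h3] at hs'M
    exact hsM hs'M.le
  have h1 := (le_abs_self _).trans (h.abs_sub_le_of_le ha hL hc
    (fun s hs => hW s (uIcc_subset_uIcc_left hz.1 hs)) hzM)
  rw [hz.2] at h1
  have h2 : |z - x| ≤ |y - x| := abs_sub_left_of_mem_uIcc hz.1
  have h3 : (1 / a + L) * M * |z - x| ≤ (1 / a + L) * M * |y - x| := by gcongr
  linarith

end IsViscousState

theorem IsViscousState.integral_field_sq {β W u : ℝ → ℝ} {ε : ℝ} {μ : Measure ℝ}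
    (h : IsViscousState β ε W μ u) :
    ∫ x, viscousField β ε W u x ^ 2 ∂μ = (viscousFisher β ε W μ).toReal := by
  rw [← h.lintegral_field_sq]
  exact integral_eq_lintegral_of_nonneg_ae (Eventually.of_forall fun x => sq_nonneg _)
    (h.aestronglyMeasurable_field.pow 2)

/-! ### Families with bounded dissipation -/

/-- A weakly convergent family of viscous states with bounded dissipation. -/
structure IsViscousFamily (β : ℝ → ℝ) (βinf : ℝ) (V : ℝ → ℝ) (Ve : ℝ → ℝ → ℝ)
    (ρe : ℝ → FiniteMeasure ℝ) (ue : ℝ → ℝ → ℝ) (ρ : FiniteMeasure ℝ) (c : ℝ) : Prop where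
  saturating : IsSaturating β βinf
  state : ∀ ε > 0, IsViscousState β ε (Ve ε) (ρe ε) (ue ε)
  continuous_deriv : Continuous (deriv V)
  tendsto_deriv : ∀ K : Set ℝ, IsCompact K →
    TendstoUniformlyOn (fun ε => deriv (Ve ε)) (deriv V) (𝓝[>] 0) K
  tendsto : Tendsto ρe (𝓝[>] 0) (𝓝 ρ)
  fisher_le : ∀ᶠ ε in 𝓝[>] 0, viscousFisher β ε (Ve ε) (ρe ε) ≤ ENNReal.ofReal c
  bound_nonneg : 0 ≤ c

/-! ### Identification of the limit density -/

/-- The function `1 / (1 + r)` on `[0,+∞]`. -/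
noncomputable def damping (r : ℝ≥0∞) : ℝ := ((1 + r)⁻¹).toReal

theorem damping_inv_ne_top (r : ℝ≥0∞) : (1 + r)⁻¹ ≠ ⊤ :=
  ENNReal.inv_ne_top.2 (by simp)

theorem continuous_damping : Continuous damping :=
  ENNReal.continuousOn_toReal.comp_continuous
    (by fun_prop) damping_inv_ne_top

theorem damping_top : damping ⊤ = 0 := by simp [damping]

theorem damping_of_ne_top {r : ℝ≥0∞} (hr : r ≠ ⊤) : damping r = (1 + r.toReal)⁻¹ := by
  rw [damping, ENNReal.toReal_inv, ENNReal.toReal_add ENNReal.one_ne_top hr, ENNReal.toReal_one]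

theorem damping_ofReal {r : ℝ} (hr : 0 ≤ r) : damping (ENNReal.ofReal r) = (1 + r)⁻¹ := by
  rw [damping_of_ne_top ENNReal.ofReal_ne_top, ENNReal.toReal_ofReal hr]

theorem damping_nonneg (r : ℝ≥0∞) : 0 ≤ damping r := ENNReal.toReal_nonneg

theorem damping_le_one (r : ℝ≥0∞) : damping r ≤ 1 := by
  rw [damping, ← ENNReal.toReal_one]
  exact ENNReal.toReal_mono ENNReal.one_ne_top (ENNReal.inv_le_one.2 le_self_add)

/-- On `{u = +∞}` the weights are `0` and `1`, so this set is Lebesgue null. On its complement the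
first weight is positive, and dividing by it gives `ρ = u ℒ¹`. What remains of `ρ` sits on a null
set and is therefore the singular part. -/
theorem IsGenContDensity.of_withDensity_damping {ρ : Measure ℝ} [IsFiniteMeasure ρ]
    {u : ℝ → ℝ≥0∞} (hu : Continuous u)
    (h : ρ.withDensity (fun x => ENNReal.ofReal (damping (u x)))
      = volume.withDensity fun x => ENNReal.ofReal (1 - damping (u x))) :
    IsGenContDensity ρ u ∧ ρ.singularPart volume = ρ.restrict (properDomain u)ᶜ ∧
      ρ.restrict (properDomain u) = volume.withDensity u := by
  set D := properDomain u with hD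
  have hDm : MeasurableSet D := (isOpen_Iio.preimage hu).measurableSet
  have hτ : Measurable fun x => ENNReal.ofReal (damping (u x)) :=
    (continuous_damping.comp hu).measurable.ennreal_ofReal
  have hκ : Measurable fun x => ENNReal.ofReal (1 - damping (u x)) :=
    (continuous_const.sub (continuous_damping.comp hu)).measurable.ennreal_ofReal
  have hnull : volume Dᶜ = 0 := by
    have h1 := congrArg (fun ν : Measure ℝ => ν Dᶜ) h
    simp only [withDensity_apply _ hDm.compl] at h1
    have htop : ∀ x ∈ Dᶜ, u x = ⊤ := fun x hx => not_lt_top_iff.1 hx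
    have h2 : ∫⁻ x in Dᶜ, ENNReal.ofReal (damping (u x)) ∂ρ = ∫⁻ _ in Dᶜ, 0 ∂ρ :=
      setLIntegral_congr_fun hDm.compl fun x hx => by
        simp only [htop x hx, damping_top, ENNReal.ofReal_zero]
    have h3 : ∫⁻ x in Dᶜ, ENNReal.ofReal (1 - damping (u x)) = ∫⁻ _ in Dᶜ, 1 :=
      setLIntegral_congr_fun hDm.compl fun x hx => by
        simp only [htop x hx, damping_top, sub_zero, ENNReal.ofReal_one]
    rw [h2, h3] at h1
    simpa using h1.symm
  have hvol : (volume : Measure ℝ).restrict D = volume :=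
    Measure.restrict_eq_self_of_ae_mem (mem_ae_iff.2 hnull)
  have hpos : ∀ x ∈ D, 0 < damping (u x) := fun x hx => by
    rw [damping_of_ne_top (ne_of_lt hx)]
    have : 0 ≤ (u x).toReal := ENNReal.toReal_nonneg
    positivity
  have hac : ρ.restrict D = volume.withDensity u := by
    have h1 : ((ρ.restrict D).withDensity fun x => ENNReal.ofReal (damping (u x)))
        = volume.withDensity fun x => ENNReal.ofReal (1 - damping (u x)) := by
      rw [← restrict_withDensity hDm, h, restrict_withDensity hDm, hvol]
    have h2 := withDensity_inv_same (μ := ρ.restrict D) hτ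
      ((ae_restrict_iff' hDm).2 (Eventually.of_forall fun x hx =>
        (ENNReal.ofReal_pos.2 (hpos x hx)).ne'))
      (Eventually.of_forall fun x => ENNReal.ofReal_ne_top)
    rw [← h2, h1]
    refine (withDensity_mul volume hκ hτ.inv).symm.trans ?_
    refine withDensity_congr_ae ?_
    filter_upwards [mem_ae_iff.2 hnull] with x hx
    have hx' : u x ≠ ⊤ := ne_of_lt hx
    have h3 : 0 ≤ (u x).toReal := ENNReal.toReal_nonneg
    simp only [Pi.mul_apply, Pi.inv_apply]
    rw [← ENNReal.ofReal_inv_of_pos (hpos x hx),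
      ← ENNReal.ofReal_mul (sub_nonneg.2 (damping_le_one _)), damping_of_ne_top hx', inv_inv,
      ← ENNReal.ofReal_toReal hx']
    congr 1
    rw [ENNReal.toReal_ofReal h3]
    field_simp
    ring
  have hdec : ρ = ρ.restrict Dᶜ + volume.withDensity u := by
    rw [← hac, Measure.restrict_compl_add_restrict hDm]
  have hsing : ρ.restrict Dᶜ ⟂ₘ volume :=
    ⟨D, hDm, by rw [Measure.restrict_apply hDm, inter_compl_self, measure_empty], hnull⟩
  have hs := Measure.eq_singularPart hu.measurable hsing hdec
  refine ⟨⟨hu, ?_, hnull, ?_⟩, hs.symm, hac⟩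
  · rw [← hs, Measure.restrict_apply hDm, inter_compl_self, measure_empty]
  · rw [← Measure.eq_withDensity_rnDeriv hu.measurable hsing hdec, hvol]

namespace IsViscousFamily

variable {β : ℝ → ℝ} {βinf : ℝ} {V : ℝ → ℝ} {Ve ue : ℝ → ℝ → ℝ} {ρe : ℝ → FiniteMeasure ℝ}
  {ρ : FiniteMeasure ℝ} {c : ℝ} {l : Filter ℝ}

theorem eventually_pos : ∀ᶠ ε : ℝ in 𝓝[>] 0, 0 < ε := self_mem_nhdsWithin

theorem eventually_energy_le (h : IsViscousFamily β βinf V Ve ρe ue ρ c) :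
    ∀ᶠ ε in 𝓝[>] 0, ∫ x, viscousField β ε (Ve ε) (ue ε) x ^ 2 ∂(ρe ε : Measure ℝ) ≤ c := by
  filter_upwards [h.fisher_le, eventually_pos] with ε h1 h2
  rw [(h.state ε h2).integral_field_sq]
  exact ENNReal.toReal_le_of_le_ofReal h.bound_nonneg h1

/-- The oscillation estimate has three terms, each made at most `η / 3`: `M` is chosen by
saturation, then `a` against the energy, then `δ` against the length. The densities themselves need
not be bounded. -/
theorem equicontinuous (h : IsViscousFamily β βinf V Ve ρe ue ρ c) (x : ℝ) {η : ℝ}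
    (hη : 0 < η) :
    ∃ δ > 0, ∀ᶠ ε in 𝓝[>] 0, ∀ y, |y - x| < δ → |β (ue ε y) - β (ue ε x)| ≤ η := by
  have hc := h.bound_nonneg
  obtain ⟨M, hM0, hM⟩ : ∃ M, 0 < M ∧ βinf - β M < η / 3 := by
    have h1 := h.saturating.tendsto.eventually (lt_mem_nhds (show βinf - η / 3 < βinf by linarith))
    obtain ⟨M, h2, h3⟩ := (h1.and (eventually_gt_atTop 0)).exists
    exact ⟨M, h3, by linarith⟩
  set K := Icc (x - 1) (x + 1)
  obtain ⟨B, hB⟩ := (isCompact_Icc (a := x - 1) (b := x + 1)).exists_bound_of_continuousOn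
    h.continuous_deriv.continuousOn
  -- The extra `1` covers the distance from `(V^ε)'` to `V'` on `K`; the bound `δ ≤ 1` below keeps
  -- the interval inside `K`.
  set L := |B| + 1
  set a := η / (3 * (c + 1)) with ha
  have hapos : 0 < a := by positivity
  have hac : a * c ≤ η / 3 := by
    rw [ha, div_mul_eq_mul_div, div_le_div_iff₀ (by positivity) (by positivity)]
    nlinarith
  have hq' : ∀ q : ℝ, 0 < q → q * (η / (3 * q)) = η / 3 := fun q hq => by field_simp
  have hq : 0 < (1 / a + L) * M := by positivity
  refine ⟨min 1 (η / (3 * ((1 / a + L) * M))), by positivity, ?_⟩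
  filter_upwards [h.eventually_energy_le, eventually_pos,
    Metric.tendstoUniformlyOn_iff.1 (h.tendsto_deriv K isCompact_Icc) 1 one_pos]
    with ε h1 h2 h3 y hy
  have hy1 := hy.trans_le (min_le_left _ _)
  have hy2 := hy.trans_le (min_le_right _ _)
  rw [abs_lt] at hy1
  have hsub : uIcc x y ⊆ K := uIcc_subset_Icc ⟨by linarith, by linarith⟩
    ⟨by linarith, by linarith⟩
  have hW : ∀ t ∈ uIcc x y, |deriv (Ve ε) t| ≤ L := fun t ht => by
    have h4 := h3 t (hsub ht)
    have h5 := hB t (hsub ht)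
    rw [dist_comm, Real.dist_eq] at h4
    rw [Real.norm_eq_abs] at h5
    have h6 := abs_sub_abs_le_abs_sub (deriv (Ve ε) t) (deriv V t)
    have := le_abs_self B
    linarith
  have h4 := (h.state ε h2).abs_sub_le h.saturating hapos (by positivity : 0 ≤ L) hM0 h1 hW
  have h5 : (1 / a + L) * M * |y - x| ≤ η / 3 := by
    calc (1 / a + L) * M * |y - x| ≤ (1 / a + L) * M * (η / (3 * ((1 / a + L) * M))) := by gcongr
      _ = η / 3 := hq' _ hq
  linarith

/-- Equicontinuity is available only for `β ∘ u^ε`; the closed embedding of `[0,+∞]` carries the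
conclusion back to the densities. -/
theorem tendstoContinuously_of_tendsto (h : IsViscousFamily β βinf V Ve ρe ue ρ c)
    (hl : l ≤ 𝓝[>] 0) {u : ℝ → ℝ≥0∞}
    (hu : ∀ x, Tendsto (fun ε => ENNReal.ofReal (ue ε x)) l (𝓝 (u x))) :
    TendstoContinuously (fun ε x => ENNReal.ofReal (ue ε x)) l u := by
  have h1 : TendstoContinuously (fun ε x => extBeta β βinf (ENNReal.ofReal (ue ε x))) l
      (fun x => extBeta β βinf (u x)) := by
    refine tendstoContinuously_of_equicontinuous
      (fun x => (h.saturating.continuous_extBeta.tendsto _).comp (hu x)) fun x η hη => ?_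
    obtain ⟨δ, hδ, h2⟩ := h.equicontinuous x hη
    refine ⟨δ, hδ, ?_⟩
    filter_upwards [hl h2, hl eventually_pos] with ε h3 h4 y hy
    rw [IsSaturating.extBeta_ofReal ((h.state ε h4).pos y).le,
      IsSaturating.extBeta_ofReal ((h.state ε h4).pos x).le]
    exact h3 y hy
  exact fun x => h.saturating.isClosedEmbedding_extBeta.tendsto_nhds_iff.2 (h1 x)

theorem eventually_continuous (h : IsViscousFamily β βinf V Ve ρe ue ρ c) {g : ℝ≥0∞ → ℝ}
    (hg : Continuous g) : ∀ᶠ ε in 𝓝[>] 0, Continuous fun x => g (ENNReal.ofReal (ue ε x)) :=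
  eventually_pos.mono fun ε hε =>
    hg.comp (ENNReal.continuous_ofReal.comp (h.state ε hε).continuous)

/-- For `ε > 0` this is the identity `u/(1+u) = 1 - 1/(1+u)`. Both weights are continuous on
`[0,+∞]`, hence converge locally uniformly, and each side passes to the limit against compactly
supported test functions. -/
theorem withDensity_damping_eq (h : IsViscousFamily β βinf V Ve ρe ue ρ c) [l.NeBot]
    (hl : l ≤ 𝓝[>] 0) {u : ℝ → ℝ≥0∞}
    (hu : TendstoContinuously (fun ε x => ENNReal.ofReal (ue ε x)) l u) :
    (ρ : Measure ℝ).withDensity (fun x => ENNReal.ofReal (damping (u x)))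
      = volume.withDensity fun x => ENNReal.ofReal (1 - damping (u x)) := by
  have hτ := hu.comp_continuous continuous_damping
  have hκ := hu.comp_continuous (g := fun r => 1 - damping r)
    (continuous_const.sub continuous_damping)
  have hint : ∀ φ : ℝ → ℝ, Continuous φ → HasCompactSupport φ →
      ∫ x, φ x * damping (u x) ∂(ρ : Measure ℝ) = ∫ x, φ x * (1 - damping (u x)) := by
    intro φ hφ hφc
    refine tendsto_nhds_unique
      (FiniteMeasure.tendsto_integral_mul_of_tendstoUniformlyOn (h.tendsto.mono_left hl) hφ hφc
        (hl (h.eventually_continuous continuous_damping)) hτ.continuous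
        (hτ.tendstoUniformlyOn hφc.isCompact)) ?_
    refine (hκ.tendsto_integral_volume (hl (h.eventually_continuous
      (g := fun r => 1 - damping r) (continuous_const.sub continuous_damping))) hφ hφc).congr' ?_
    filter_upwards [hl eventually_pos] with ε hε
    rw [(h.state ε hε).integral_eq]
    refine integral_congr_ae (Eventually.of_forall fun x => ?_)
    have hp := (h.state ε hε).pos x
    simp only [damping_ofReal hp.le]
    field_simp
    ring
  have hτc : Continuous fun x => damping (u x) := hτ.continuous
  have hκc : Continuous fun x => 1 - damping (u x) := hκ.continuous
  have hfin1 : IsLocallyFiniteMeasure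
      ((ρ : Measure ℝ).withDensity fun x => ENNReal.ofReal (damping (u x))) :=
    IsLocallyFiniteMeasure.withDensity_ofReal hτc
  have hfin2 : IsLocallyFiniteMeasure
      ((volume : Measure ℝ).withDensity fun x => ENNReal.ofReal (1 - damping (u x))) :=
    IsLocallyFiniteMeasure.withDensity_ofReal hκc
  refine Measure.ext_of_integral_eq_on_compactlySupported fun φ => ?_
  rw [integral_withDensity_eq_integral_toReal_smul hτc.measurable.ennreal_ofReal
      (Eventually.of_forall fun x => ENNReal.ofReal_lt_top),
    integral_withDensity_eq_integral_toReal_smul hκc.measurable.ennreal_ofReal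
      (Eventually.of_forall fun x => ENNReal.ofReal_lt_top)]
  simp only [ENNReal.toReal_ofReal (damping_nonneg _),
    ENNReal.toReal_ofReal (sub_nonneg.2 (damping_le_one _)), smul_eq_mul]
  simpa only [mul_comm] using hint φ φ.continuous φ.hasCompactSupport

/-- The densities converge continuously to the generalized continuous density of the limit. -/
theorem exists_density (h : IsViscousFamily β βinf V Ve ρe ue ρ c) :
    ∃ u : ℝ → ℝ≥0∞, IsGenContDensity ρ u ∧
      (ρ : Measure ℝ).singularPart volume = (ρ : Measure ℝ).restrict (properDomain u)ᶜ ∧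
      (ρ : Measure ℝ).restrict (properDomain u) = volume.withDensity u ∧
      TendstoContinuously (fun ε x => ENNReal.ofReal (ue ε x)) (𝓝[>] 0) u := by
  -- Along an ultrafilter, compactness of `[0,+∞]` gives a limit at every point at once, with no
  -- extraction of subsequences.
  have key : ∀ l : Ultrafilter ℝ, ↑l ≤ 𝓝[>] (0 : ℝ) → ∃ u : ℝ → ℝ≥0∞,
      (∀ x, Tendsto (fun ε => ENNReal.ofReal (ue ε x)) l (𝓝 (u x))) ∧ IsGenContDensity ρ u ∧
      (ρ : Measure ℝ).singularPart volume = (ρ : Measure ℝ).restrict (properDomain u)ᶜ ∧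
      (ρ : Measure ℝ).restrict (properDomain u) = volume.withDensity u := by
    intro l hl
    have hlim : ∀ x, ∃ r : ℝ≥0∞, Tendsto (fun ε => ENNReal.ofReal (ue ε x)) l (𝓝 r) := fun x => by
      obtain ⟨r, -, hr⟩ := isCompact_univ.ultrafilter_le_nhds
        (l.map fun ε => ENNReal.ofReal (ue ε x)) (by simp)
      exact ⟨r, hr⟩
    choose u hu using hlim
    have hc := h.tendstoContinuously_of_tendsto hl hu
    have hd := IsGenContDensity.of_withDensity_damping hc.continuous
      (h.withDensity_damping_eq hl hc)
    exact ⟨u, hu, hd.1, hd.2.1, hd.2.2⟩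
  obtain ⟨u, -, hu, hus, hua⟩ := key (Ultrafilter.of (𝓝[>] 0)) (Ultrafilter.of_le _)
  refine ⟨u, hu, hus, hua, h.tendstoContinuously_of_tendsto le_rfl fun x => ?_⟩
  rw [tendsto_iff_ultrafilter]
  intro l hl
  obtain ⟨v, hv, hv', -, -⟩ := key l hl
  -- All ultrafilter limits are densities of the same `ρ`, so they coincide and the whole family
  -- converges.
  rw [hu.unique hv']
  exact hv x

end IsViscousFamily

/-! ### Limits of the fluxes -/

namespace IsViscousFamily

variable {β : ℝ → ℝ} {βinf : ℝ} {V : ℝ → ℝ} {Ve ue : ℝ → ℝ → ℝ} {ρe : ℝ → FiniteMeasure ℝ}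
  {ρ : FiniteMeasure ℝ} {c : ℝ} {u : ℝ → ℝ≥0∞}

theorem tendstoContinuously_deriv (h : IsViscousFamily β βinf V Ve ρe ue ρ c) :
    TendstoContinuously (fun ε => deriv (Ve ε)) (𝓝[>] 0) (deriv V) := by
  intro x
  rw [Metric.tendsto_nhds]
  intro η hη
  have h1 := Metric.tendstoUniformlyOn_iff.1
    (h.tendsto_deriv (Icc (x - 1) (x + 1)) isCompact_Icc) (η / 2) (half_pos hη)
  have h2 := (h.continuous_deriv.tendsto x).eventually (Metric.ball_mem_nhds _ (half_pos hη))
  filter_upwards [h1.prod_mk (h2.and (Icc_mem_nhds (show x - 1 < x by linarith)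
    (show x < x + 1 by linarith)))] with p hp
  have h3 := hp.1 p.2 hp.2.2
  have h4 : dist (deriv V p.2) (deriv V x) < η / 2 := hp.2.1
  have := dist_triangle_left (deriv (Ve p.1) p.2) (deriv V x) (deriv V p.2)
  linarith

theorem eventually_mass_le (h : IsViscousFamily β βinf V Ve ρe ue ρ c) :
    ∀ᶠ ε in 𝓝[>] 0, ((ρe ε : Measure ℝ).real univ) ≤ ρ.mass + 1 := by
  filter_upwards [((FiniteMeasure.continuous_mass.tendsto ρ).comp h.tendsto).eventually_le_const
    (lt_add_one ρ.mass)] with ε hε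
  have : ((ρe ε).mass : ℝ) ≤ ((ρ.mass + 1 : ℝ≥0) : ℝ) := NNReal.coe_le_coe.2 hε
  simpa using this

/-- From `|ξ| ≤ ξ² + 1`. The resulting `L¹` bound is what permits multiplying test functions by
locally uniformly convergent factors. -/
theorem eventually_integral_abs_le (h : IsViscousFamily β βinf V Ve ρe ue ρ c) :
    ∀ᶠ ε in 𝓝[>] 0, Integrable (viscousField β ε (Ve ε) (ue ε)) (ρe ε : Measure ℝ) ∧
      ∫ x, |viscousField β ε (Ve ε) (ue ε) x| ∂(ρe ε : Measure ℝ) ≤ c + (ρ.mass + 1) := by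
  filter_upwards [h.eventually_energy_le, h.eventually_mass_le, eventually_pos] with ε h1 h2 h3
  have hL := (h.state ε h3).memLp_field
  have hi : Integrable (viscousField β ε (Ve ε) (ue ε)) (ρe ε : Measure ℝ) :=
    hL.integrable (by norm_num)
  refine ⟨hi, ?_⟩
  calc ∫ x, |viscousField β ε (Ve ε) (ue ε) x| ∂(ρe ε : Measure ℝ)
      ≤ ∫ x, (viscousField β ε (Ve ε) (ue ε) x ^ 2 + 1) ∂(ρe ε : Measure ℝ) := by
        refine integral_mono hi.abs (hL.integrable_sq.add (integrable_const 1)) fun x => ?_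
        simp only
        rw [← sq_abs]
        nlinarith [sq_nonneg (|viscousField β ε (Ve ε) (ue ε) x| - 1),
          abs_nonneg (viscousField β ε (Ve ε) (ue ε) x)]
    _ = ∫ x, viscousField β ε (Ve ε) (ue ε) x ^ 2 ∂(ρe ε : Measure ℝ)
        + (ρe ε : Measure ℝ).real univ := by
        rw [integral_add hL.integrable_sq (integrable_const 1)]
        simp
    _ ≤ c + (ρ.mass + 1) := add_le_add h1 h2

theorem integrable_density {ε : ℝ} (h : IsViscousFamily β βinf V Ve ρe ue ρ c) (hε : 0 < ε) :
    Integrable (ue ε) volume := by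
  have := (h.state ε hε).integrable_iff.1 (integrable_const (1 : ℝ))
  simpa using this

/-- Limit of the weak formulation of the chain rule for `p ∘ β`. -/
theorem tendsto_integral_flux (h : IsViscousFamily β βinf V Ve ρe ue ρ c)
    (hu : TendstoContinuously (fun ε x => ENNReal.ofReal (ue ε x)) (𝓝[>] 0) u)
    {p p' : ℝ → ℝ} (hp : ∀ s, HasDerivAt p (p' s) s) (hp' : Continuous p')
    {ζ : ℝ → ℝ} (hζ : ContDiff ℝ ∞ ζ) (hζc : HasCompactSupport ζ) :
    Tendsto (fun ε => ∫ x, ζ x * (p' (β (ue ε x)) *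
        (viscousField β ε (Ve ε) (ue ε) x - deriv (Ve ε) x)) ∂(ρe ε : Measure ℝ)) (𝓝[>] 0)
      (𝓝 (- ∫ x, deriv ζ x * p (extBeta β βinf (u x)))) := by
  have hβ := h.saturating
  have hpc : Continuous p := continuous_iff_continuousAt.2 fun s => (hp s).continuousAt
  have hζ' : Continuous (deriv ζ) := hζ.continuous_deriv (by exact_mod_cast le_top)
  -- `β` is controlled only on `[0,+∞)`; `max s 0` extends `p' ∘ β` continuously to the line.
  have hθ : Continuous fun s => p' (β (max s 0)) :=
    hp'.comp (hβ.continuousOn.comp_continuous (continuous_id.max continuous_const)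
      fun s => mem_Ici.2 (le_max_right s 0))
  -- With this primitive, `p ∘ β + ε T` has derivative `p'(β) (β' + ε)`, exactly the form required
  -- by the chain rule with `θ = p' ∘ β`.
  set T : ℝ → ℝ := fun r => ∫ s in (0 : ℝ)..r, p' (β (max s 0)) with hT
  have hTd : ∀ r, HasDerivAt T (p' (β (max r 0))) r := fun r =>
    intervalIntegral.integral_hasDerivAt_right (hθ.intervalIntegrable _ _)
      (hθ.stronglyMeasurableAtFilter _ _) hθ.continuousAt
  have hTc : Continuous T := continuous_iff_continuousAt.2 fun r => (hTd r).continuousAt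
  obtain ⟨C, hC⟩ := (isCompact_Icc (a := (0 : ℝ)) (b := βinf)).exists_bound_of_continuousOn
    hp'.continuousOn
  have hC0 : 0 ≤ C := (norm_nonneg _).trans (hC 0 ⟨le_rfl, hβ.limit_pos.le⟩)
  have hTb : ∀ r, 0 ≤ r → |T r| ≤ C * r := fun r hr => by
    have := intervalIntegral.norm_integral_le_of_norm_le_const (a := 0) (b := r) (C := C)
      (f := fun s => p' (β (max s 0))) fun s _ =>
        hC _ ⟨hβ.nonneg (le_max_right _ _), (hβ.lt_limit (le_max_right _ _)).le⟩
    rwa [sub_zero, abs_of_nonneg hr] at this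
  obtain ⟨B, hB⟩ := hζc.deriv.exists_bound_of_continuous hζ'
  have hB0 : 0 ≤ B := (norm_nonneg _).trans (hB 0)
  have hmain := (hu.comp_continuous (hpc.comp hβ.continuous_extBeta)).tendsto_integral_volume
    (h.eventually_continuous (hpc.comp hβ.continuous_extBeta)) hζ' hζc.deriv
  -- Since `T` grows at most linearly and the masses are bounded, the integrals stay bounded and the
  -- factor `ε` makes the term vanish.
  have hrest : Tendsto (fun ε => ε * ∫ x, deriv ζ x * T (ue ε x)) (𝓝[>] 0) (𝓝 0) := by
    have h0 : Tendsto (fun ε : ℝ => ε * (B * C * (ρ.mass + 1))) (𝓝[>] 0) (𝓝 0) := by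
      have : Tendsto (fun ε : ℝ => ε * (B * C * (ρ.mass + 1))) (𝓝 0)
        (𝓝 (0 * (B * C * (ρ.mass + 1)))) := (continuous_id.mul continuous_const).tendsto 0
      rw [zero_mul] at this
      exact this.mono_left nhdsWithin_le_nhds
    refine squeeze_zero_norm' ?_ h0
    filter_upwards [eventually_pos, h.eventually_mass_le] with ε hε hm
    rw [norm_mul, Real.norm_of_nonneg hε.le]
    refine mul_le_mul_of_nonneg_left ?_ hε.le
    calc ‖∫ x, deriv ζ x * T (ue ε x)‖ ≤ ∫ x, B * C * ue ε x := by
          refine norm_integral_le_of_norm_le ((h.integrable_density hε).const_mul _)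
            (Eventually.of_forall fun x => ?_)
          rw [norm_mul, mul_assoc]
          exact mul_le_mul (hB x) (hTb _ ((h.state ε hε).pos x).le) (norm_nonneg _) hB0
      _ = B * C * (ρe ε : Measure ℝ).real univ := by
          rw [integral_const_mul]
          have := (h.state ε hε).integral_eq fun _ => 1
          simp only [integral_const, smul_eq_mul, mul_one, one_mul] at this
          rw [this]
      _ ≤ B * C * (ρ.mass + 1) := by gcongr
  have hsum := (hmain.add hrest).neg
  rw [add_zero] at hsum
  refine hsum.congr' ?_
  filter_upwards [eventually_pos] with ε hε
  have hst := h.state ε hε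
  have hF := hst.integral_deriv_mul_comp (F := fun r => p (β r) + ε * T r)
    (θ := fun r => p' (β (max r 0))) (fun r hr => by
      have h1 := ((hp (β r)).comp r (hst.hasDerivAt r hr)).add ((hTd r).const_mul ε)
      rw [max_eq_left hr.le] at h1 ⊢
      exact h1.congr_deriv (by ring)) hθ.continuousOn hζ hζc
  have hpe : ∀ x, p (extBeta β βinf (ENNReal.ofReal (ue ε x))) = p (β (ue ε x)) := fun x => by
    rw [IsSaturating.extBeta_ofReal (hst.pos x).le]
  have hβu : Continuous fun x => β (ue ε x) :=
    hβ.continuousOn.comp_continuous hst.continuous fun x => (hst.pos x).le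
  have hsplit : ∫ x, deriv ζ x * (p (β (ue ε x)) + ε * T (ue ε x))
      = (∫ x, deriv ζ x * p (β (ue ε x))) + ε * ∫ x, deriv ζ x * T (ue ε x) := by
    rw [← integral_const_mul, ← integral_add]
    · exact integral_congr_ae (Eventually.of_forall fun x => by ring)
    · exact (hζ'.mul (hpc.comp hβu)).integrable_of_hasCompactSupport hζc.deriv.mul_right
    · exact ((hζ'.mul (hTc.comp hst.continuous)).integrable_of_hasCompactSupport
        hζc.deriv.mul_right).const_mul ε
  simp only [hpe, Function.comp_apply]
  rw [← hsplit, hF, neg_neg]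
  refine integral_congr_ae (Eventually.of_forall fun x => ?_)
  simp only [max_eq_left (hst.pos x).le]

/-- The limit flux. -/
theorem exists_flux (h : IsViscousFamily β βinf V Ve ρe ue ρ c)
    (hu : TendstoContinuously (fun ε x => ENNReal.ofReal (ue ε x)) (𝓝[>] 0) u) :
    ∃ ξ : ℝ → ℝ, MemLp ξ 2 (ρ : Measure ℝ) ∧
      ENNReal.ofReal (∫ x, ξ x ^ 2 ∂(ρ : Measure ℝ))
        ≤ liminf (fun ε => viscousFisher β ε (Ve ε) (ρe ε)) (𝓝[>] 0) ∧
      ∀ φ : BoundedContinuousFunction ℝ ℝ,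
        Tendsto (fun ε => ∫ x, φ x * viscousField β ε (Ve ε) (ue ε) x ∂(ρe ε : Measure ℝ))
          (𝓝[>] 0) (𝓝 (∫ x, φ x * ξ x ∂(ρ : Measure ℝ))) := by
  -- With `p = id`, the limit against smooth test functions exists along the full filter; it will
  -- identify the limits obtained along different ultrafilters.
  have hsmooth : ∀ ζ : ℝ → ℝ, ContDiff ℝ ∞ ζ → HasCompactSupport ζ →
      Tendsto (fun ε => ∫ x, ζ x * viscousField β ε (Ve ε) (ue ε) x ∂(ρe ε : Measure ℝ))
        (𝓝[>] 0) (𝓝 ((- ∫ x, deriv ζ x * extBeta β βinf (u x))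
          + ∫ x, ζ x * deriv V x ∂(ρ : Measure ℝ))) := by
    intro ζ hζ hζc
    have h1 := h.tendsto_integral_flux hu (p := fun s => s) (p' := fun _ => 1)
      (fun s => hasDerivAt_id s) continuous_const hζ hζc
    have h2 := FiniteMeasure.tendsto_integral_mul_of_tendstoUniformlyOn h.tendsto hζ.continuous hζc
      (eventually_pos.mono fun ε hε => (h.state ε hε).continuous_deriv_potential)
      h.continuous_deriv (h.tendsto_deriv _ hζc.isCompact)
    refine (h1.add h2).congr' ?_
    filter_upwards [eventually_pos, h.eventually_integral_abs_le] with ε hε hi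
    have hst := h.state ε hε
    have i2 : Integrable (fun x => ζ x * deriv (Ve ε) x) (ρe ε : Measure ℝ) :=
      (hζ.continuous.mul hst.continuous_deriv_potential).integrable_of_hasCompactSupport
        hζc.mul_right
    obtain ⟨B, hB⟩ := hζc.exists_bound_of_continuous hζ.continuous
    have i1 := integrable_bounded_mul hζ.continuous hB hi.1
    rw [← integral_add _ i2]
    · exact integral_congr_ae (Eventually.of_forall fun x => by ring)
    · refine (i1.sub i2).congr (Eventually.of_forall fun x => ?_)
      simp only [Pi.sub_apply]
      ring
  have key : ∀ (l : Ultrafilter ℝ) (b : ℝ), ↑l ≤ 𝓝[>] (0 : ℝ) → 0 ≤ b →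
      (∀ᶠ ε in (l : Filter ℝ), viscousFisher β ε (Ve ε) (ρe ε) ≤ ENNReal.ofReal b) →
      ∃ ξ : ℝ → ℝ, MemLp ξ 2 (ρ : Measure ℝ) ∧ ∫ x, ξ x ^ 2 ∂(ρ : Measure ℝ) ≤ b ∧
        ∀ φ : BoundedContinuousFunction ℝ ℝ,
          Tendsto (fun ε => ∫ x, φ x * viscousField β ε (Ve ε) (ue ε) x ∂(ρe ε : Measure ℝ)) l
            (𝓝 (∫ x, φ x * ξ x ∂(ρ : Measure ℝ))) := fun l b hl hb hlb => by
    refine exists_weak_limit_of_energy_le l (h.tendsto.mono_left hl) hb ?_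
    filter_upwards [hl eventually_pos, hlb] with ε hε hεb
    refine ⟨(h.state ε hε).memLp_field, ?_⟩
    rw [(h.state ε hε).integral_field_sq]
    exact ENNReal.toReal_le_of_le_ofReal hb hεb
  have hunique : ∀ (l l' : Ultrafilter ℝ), ↑l ≤ 𝓝[>] (0 : ℝ) → ↑l' ≤ 𝓝[>] (0 : ℝ) →
      ∀ ξ ξ' : ℝ → ℝ, MemLp ξ 2 (ρ : Measure ℝ) → MemLp ξ' 2 (ρ : Measure ℝ) →
      (∀ φ : BoundedContinuousFunction ℝ ℝ,
        Tendsto (fun ε => ∫ x, φ x * viscousField β ε (Ve ε) (ue ε) x ∂(ρe ε : Measure ℝ)) l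
          (𝓝 (∫ x, φ x * ξ x ∂(ρ : Measure ℝ)))) →
      (∀ φ : BoundedContinuousFunction ℝ ℝ,
        Tendsto (fun ε => ∫ x, φ x * viscousField β ε (Ve ε) (ue ε) x ∂(ρe ε : Measure ℝ)) l'
          (𝓝 (∫ x, φ x * ξ' x ∂(ρ : Measure ℝ)))) → ξ =ᵐ[(ρ : Measure ℝ)] ξ' := by
    intro l l' hl hl' ξ ξ' hξ hξ' hlim hlim'
    refine ae_eq_of_integral_contDiff_smul_eq (hξ.integrable (by norm_num)).locallyIntegrable
      (hξ'.integrable (by norm_num)).locallyIntegrable fun ζ hζ hζc => ?_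
    obtain ⟨B, hB⟩ := hζc.exists_bound_of_continuous hζ.continuous
    let φ := BoundedContinuousFunction.ofNormedAddCommGroup ζ hζ.continuous B hB
    exact (tendsto_nhds_unique (hlim φ) ((hsmooth ζ hζ hζc).mono_left hl)).trans
      (tendsto_nhds_unique (hlim' φ) ((hsmooth ζ hζ hζc).mono_left hl')).symm
  have hl₀ := Ultrafilter.of_le (𝓝[>] (0 : ℝ))
  obtain ⟨ξ, hξ, -, hlim⟩ := key (Ultrafilter.of (𝓝[>] 0)) c hl₀ h.bound_nonneg
    (hl₀ h.fisher_le)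
  refine ⟨ξ, hξ, ?_, fun φ => ?_⟩
  · refine le_of_forall_gt fun b hb => ?_
    rcases eq_or_ne b ⊤ with rfl | hbt
    · exact ENNReal.ofReal_lt_top
    -- Some ultrafilter lives on the set where the dissipation is below `b'`. Its limit field has
    -- energy at most `b'` and is the same `ξ`.
    obtain ⟨b', hb1, hb2⟩ := exists_between hb
    have hfreq := frequently_lt_of_liminf_lt (by isBoundedDefault) hb1
    have hne : (𝓝[>] (0 : ℝ) ⊓ 𝓟 {ε | viscousFisher β ε (Ve ε) (ρe ε) < b'}).NeBot :=
      frequently_mem_iff_neBot.1 hfreq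
    have hle := Ultrafilter.of_le
      (𝓝[>] (0 : ℝ) ⊓ 𝓟 {ε | viscousFisher β ε (Ve ε) (ρe ε) < b'})
    have hb't : b' ≠ ⊤ := (hb2.trans_le le_top).ne
    obtain ⟨ξ', hξ', hb', hlim'⟩ := key _ b'.toReal (hle.trans inf_le_left)
      ENNReal.toReal_nonneg (by
        filter_upwards [hle (mem_inf_of_right (mem_principal_self _))] with ε hε
        rw [ENNReal.ofReal_toReal hb't]
        exact le_of_lt hε)
    have heq := hunique _ _ hl₀ (hle.trans inf_le_left) ξ ξ' hξ hξ' hlim hlim'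
    have h1 : ∫ x, ξ x ^ 2 ∂(ρ : Measure ℝ) = ∫ x, ξ' x ^ 2 ∂(ρ : Measure ℝ) :=
      integral_congr_ae (heq.mono fun x hx => by simp only [hx])
    rw [h1]
    exact (ENNReal.ofReal_le_of_le_toReal hb').trans_lt hb2
  · rw [tendsto_iff_ultrafilter]
    intro l hl
    obtain ⟨ξ', hξ', -, hlim'⟩ := key l c hl h.bound_nonneg (hl h.fisher_le)
    have heq := hunique _ _ hl₀ hl ξ ξ' hξ hξ' hlim hlim'
    have h1 : ∫ x, φ x * ξ x ∂(ρ : Measure ℝ) = ∫ x, φ x * ξ' x ∂(ρ : Measure ℝ) :=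
      integral_congr_ae (heq.mono fun x hx => by simp only [hx])
    rw [h1]
    exact hlim' φ

end IsViscousFamily

/-! ### Splitting the flux between the finite and the infinite set of the density -/

/-- Polynomial approximations of the identity on `[0,b]` whose derivatives vanish at `b`. -/
theorem hasDerivAt_flattening {b : ℝ} (hb : 0 < b) (k : ℕ) (s : ℝ) :
    HasDerivAt (fun s => s - b / (k + 1) * (s / b) ^ (k + 1)) (1 - (s / b) ^ k) s := by
  have h1 := (((hasDerivAt_id s).div_const b).pow (k + 1)).const_mul (b / (k + 1) : ℝ)
  refine ((hasDerivAt_id s).sub h1).congr_deriv ?_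
  have : (k : ℝ) + 1 ≠ 0 := by positivity
  simp only [id, Nat.add_sub_cancel]
  push_cast
  field_simp

namespace IsViscousFamily

variable {β : ℝ → ℝ} {βinf : ℝ} {V : ℝ → ℝ} {Ve ue : ℝ → ℝ → ℝ} {ρe : ℝ → FiniteMeasure ℝ}
  {ρ : FiniteMeasure ℝ} {c : ℝ} {u : ℝ → ℝ≥0∞} {ξ : ℝ → ℝ}

/-- The same integrals have two limits: one from the weak chain rule, the other from the convergence
of the flux, where the factor `p'(β(u^ε))` may be included because it converges locally uniformly,
also near `{u = +∞}`. -/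
theorem integral_comp_mul_flux (h : IsViscousFamily β βinf V Ve ρe ue ρ c)
    (hu : TendstoContinuously (fun ε x => ENNReal.ofReal (ue ε x)) (𝓝[>] 0) u)
    (hξ : MemLp ξ 2 (ρ : Measure ℝ))
    (hlim : ∀ φ : BoundedContinuousFunction ℝ ℝ,
        Tendsto (fun ε => ∫ x, φ x * viscousField β ε (Ve ε) (ue ε) x ∂(ρe ε : Measure ℝ))
          (𝓝[>] 0) (𝓝 (∫ x, φ x * ξ x ∂(ρ : Measure ℝ))))
    {p p' : ℝ → ℝ} (hp : ∀ s, HasDerivAt p (p' s) s) (hp' : Continuous p')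
    {ζ : ℝ → ℝ} (hζ : ContDiff ℝ ∞ ζ) (hζc : HasCompactSupport ζ) :
    ∫ x, ζ x * p' (extBeta β βinf (u x)) * (ξ x - deriv V x) ∂(ρ : Measure ℝ)
      = - ∫ x, deriv ζ x * p (extBeta β βinf (u x)) := by
  have hβ := h.saturating
  have hθ := hu.comp_continuous (hp'.comp hβ.continuous_extBeta)
  have hθc := hθ.continuous
  have hθe := h.eventually_continuous (hp'.comp hβ.continuous_extBeta)
  have hprod : TendstoContinuously (fun ε x =>
      p' (extBeta β βinf (ENNReal.ofReal (ue ε x))) * deriv (Ve ε) x) (𝓝[>] 0)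
      (fun x => p' (extBeta β βinf (u x)) * deriv V x) := fun x =>
    (hθ x).mul (h.tendstoContinuously_deriv x)
  have hcs : HasCompactSupport fun x => ζ x * p' (extBeta β βinf (u x)) := hζc.mul_right
  obtain ⟨B, hB⟩ := hcs.exists_bound_of_continuous (hζ.continuous.mul hθc)
  have h1 := tendsto_integral_mul_of_tendstoUniformlyOn h.eventually_integral_abs_le
    hζ.continuous hζc hθe hθc (hθ.tendstoUniformlyOn hζc.isCompact)
    (hlim (BoundedContinuousFunction.ofNormedAddCommGroup _ (hζ.continuous.mul hθc) B hB))
  have h2 := FiniteMeasure.tendsto_integral_mul_of_tendstoUniformlyOn h.tendsto hζ.continuous hζc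
    (by
      filter_upwards [eventually_pos, hθe] with ε hε hc
      exact hc.mul (h.state ε hε).continuous_deriv_potential)
    hprod.continuous (hprod.tendstoUniformlyOn hζc.isCompact)
  have h3 := h.tendsto_integral_flux hu hp hp' hζ hζc
  have i1 : Integrable (fun x => ζ x * p' (extBeta β βinf (u x)) * ξ x) (ρ : Measure ℝ) :=
    integrable_bounded_mul (hζ.continuous.mul hθc) hB (hξ.integrable (by norm_num))
  have i2 : Integrable (fun x => ζ x * (p' (extBeta β βinf (u x)) * deriv V x))
      (ρ : Measure ℝ) :=
    (hζ.continuous.mul (hθc.mul h.continuous_deriv)).integrable_of_hasCompactSupport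
      hζc.mul_right
  have h4 : ∫ x, ζ x * p' (extBeta β βinf (u x)) * (ξ x - deriv V x) ∂(ρ : Measure ℝ)
      = (∫ x, ζ x * p' (extBeta β βinf (u x)) * ξ x ∂(ρ : Measure ℝ))
        - ∫ x, ζ x * (p' (extBeta β βinf (u x)) * deriv V x) ∂(ρ : Measure ℝ) := by
    rw [← integral_sub i1 i2]
    exact integral_congr_ae (Eventually.of_forall fun x => by ring)
  rw [h4]
  refine tendsto_nhds_unique ((h1.sub h2).congr' ?_) h3
  filter_upwards [eventually_pos, h.eventually_integral_abs_le, hθe] with ε hε hi hc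
  have hst := h.state ε hε
  have hcs' : HasCompactSupport fun x =>
    ζ x * p' (extBeta β βinf (ENNReal.ofReal (ue ε x))) := hζc.mul_right
  obtain ⟨B', hB'⟩ := hcs'.exists_bound_of_continuous (hζ.continuous.mul hc)
  refine (integral_sub (integrable_bounded_mul (hζ.continuous.mul hc) hB' hi.1)
    ((hζ.continuous.mul (hc.mul
      hst.continuous_deriv_potential)).integrable_of_hasCompactSupport hζc.mul_right)).symm.trans ?_
  refine integral_congr_ae (Eventually.of_forall fun x => ?_)
  simp only [Pi.mul_apply, Function.comp_apply, IsSaturating.extBeta_ofReal (hst.pos x).le]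
  ring

/-- The part of the limit flux on the set where the density is finite determines the
distributional derivative of `β ∘ u`. -/
theorem setIntegral_flux (h : IsViscousFamily β βinf V Ve ρe ue ρ c)
    (hu : TendstoContinuously (fun ε x => ENNReal.ofReal (ue ε x)) (𝓝[>] 0) u)
    (hξ : MemLp ξ 2 (ρ : Measure ℝ))
    (hlim : ∀ φ : BoundedContinuousFunction ℝ ℝ,
        Tendsto (fun ε => ∫ x, φ x * viscousField β ε (Ve ε) (ue ε) x ∂(ρe ε : Measure ℝ))
          (𝓝[>] 0) (𝓝 (∫ x, φ x * ξ x ∂(ρ : Measure ℝ))))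
    {ζ : ℝ → ℝ} (hζ : ContDiff ℝ ∞ ζ) (hζc : HasCompactSupport ζ) :
    ∫ x in properDomain u, ζ x * (ξ x - deriv V x) ∂(ρ : Measure ℝ)
      = - ∫ x, deriv ζ x * extBeta β βinf (u x) := by
  have hβ := h.saturating
  have hb := hβ.limit_pos
  have hDm : MeasurableSet (properDomain u) := (isOpen_Iio.preimage hu.continuous).measurableSet
  have hw : Continuous fun x => extBeta β βinf (u x) := hβ.continuous_extBeta.comp hu.continuous
  have hratio : ∀ x, 0 ≤ extBeta β βinf (u x) / βinf ∧ extBeta β βinf (u x) / βinf ≤ 1 :=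
    fun x => ⟨div_nonneg (hβ.extBeta_nonneg _) hb.le, (div_le_one hb).2 (hβ.extBeta_le _)⟩
  have hpow : ∀ x (k : ℕ), 0 ≤ (extBeta β βinf (u x) / βinf) ^ k ∧
      (extBeta β βinf (u x) / βinf) ^ k ≤ 1 := fun x k =>
    ⟨pow_nonneg (hratio x).1 k, pow_le_one₀ (hratio x).1 (hratio x).2⟩
  obtain ⟨B, hB⟩ := hζc.exists_bound_of_continuous hζ.continuous
  have hζ' : Continuous (deriv ζ) := hζ.continuous_deriv (by exact_mod_cast le_top)
  have i1 : Integrable (fun x => ζ x * (ξ x - deriv V x)) (ρ : Measure ℝ) := by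
    refine ((integrable_bounded_mul hζ.continuous hB (hξ.integrable (by norm_num))).sub
      ((hζ.continuous.mul h.continuous_deriv).integrable_of_hasCompactSupport
        hζc.mul_right)).congr (Eventually.of_forall fun x => ?_)
    simp only [Pi.sub_apply, Pi.mul_apply]
    ring
  -- The ratio `β(u)/βinf` is less than `1` exactly where `u` is finite, so the factors tend to the
  -- indicator of that set.
  have hleft : Tendsto (fun k : ℕ => ∫ x, ζ x * (1 - (extBeta β βinf (u x) / βinf) ^ k)
        * (ξ x - deriv V x) ∂(ρ : Measure ℝ)) atTop
      (𝓝 (∫ x in properDomain u, ζ x * (ξ x - deriv V x) ∂(ρ : Measure ℝ))) := by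
    rw [← integral_indicator hDm]
    refine tendsto_integral_of_dominated_convergence (fun x => |ζ x * (ξ x - deriv V x)|)
      (fun k => ?_) i1.abs (fun k => Eventually.of_forall fun x => ?_)
      (Eventually.of_forall fun x => ?_)
    · have hc : Continuous fun x => 1 - (extBeta β βinf (u x) / βinf) ^ k := by fun_prop
      refine (hc.aestronglyMeasurable.mul i1.aestronglyMeasurable).congr
        (Eventually.of_forall fun x => ?_)
      simp only [Pi.mul_apply]
      ring
    · rw [mul_right_comm, norm_mul, Real.norm_eq_abs, Real.norm_eq_abs]
      refine mul_le_of_le_one_right (abs_nonneg _) ?_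
      rw [abs_le]
      constructor <;> linarith [(hpow x k).1, (hpow x k).2]
    · by_cases hx : x ∈ properDomain u
      · rw [indicator_of_mem hx]
        have h1 := tendsto_pow_atTop_nhds_zero_of_lt_one (hratio x).1
          ((div_lt_one hb).2 (hβ.extBeta_lt (ne_of_lt hx)))
        have h2 := ((h1.const_sub 1).const_mul (ζ x)).mul_const (ξ x - deriv V x)
        rwa [sub_zero, mul_one] at h2
      · rw [indicator_of_notMem hx]
        have h1 : u x = ⊤ := not_lt_top_iff.1 hx
        simp only [h1, IsSaturating.extBeta_top, div_self hb.ne', one_pow, sub_self, mul_zero,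
          zero_mul]
        exact tendsto_const_nhds
  -- The correction to the identity is at most `βinf / (k + 1)`, uniformly in `x`.
  have hright : Tendsto (fun k : ℕ => ∫ x, deriv ζ x * (extBeta β βinf (u x)
        - βinf / (k + 1) * (extBeta β βinf (u x) / βinf) ^ (k + 1))) atTop
      (𝓝 (∫ x, deriv ζ x * extBeta β βinf (u x))) := by
    have hto : Tendsto (fun k : ℕ => βinf / ((k : ℝ) + 1)) atTop (𝓝 0) := by
      have := (tendsto_one_div_add_atTop_nhds_zero_nat (𝕜 := ℝ)).const_mul βinf
      simpa [div_eq_mul_inv] using this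
    have hle : ∀ k : ℕ, βinf / ((k : ℝ) + 1) ≤ βinf := fun k =>
      div_le_self hb.le (by linarith [(Nat.cast_nonneg k : (0 : ℝ) ≤ k)])
    have hnn : ∀ k : ℕ, 0 ≤ βinf / ((k : ℝ) + 1) := fun k => by positivity
    refine tendsto_integral_of_dominated_convergence (fun x => |deriv ζ x| * (2 * βinf))
      (fun k => ?_) ?_ (fun k => Eventually.of_forall fun x => ?_)
      (Eventually.of_forall fun x => ?_)
    · have hc : Continuous fun x => deriv ζ x * (extBeta β βinf (u x)
        - βinf / (k + 1) * (extBeta β βinf (u x) / βinf) ^ (k + 1)) := by fun_prop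
      exact hc.aestronglyMeasurable
    · exact (hζ'.integrable_of_hasCompactSupport hζc.deriv).abs.mul_const _
    · rw [norm_mul, Real.norm_eq_abs, Real.norm_eq_abs]
      refine mul_le_mul_of_nonneg_left ?_ (abs_nonneg _)
      have h1 : 0 ≤ βinf / ((k : ℝ) + 1) * (extBeta β βinf (u x) / βinf) ^ (k + 1) :=
        mul_nonneg (hnn k) (hpow x _).1
      have h2 : βinf / ((k : ℝ) + 1) * (extBeta β βinf (u x) / βinf) ^ (k + 1) ≤ βinf :=
        (mul_le_of_le_one_right (hnn k) (hpow x _).2).trans (hle k)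
      rw [abs_le]
      constructor <;> linarith [hβ.extBeta_nonneg (u x), hβ.extBeta_le (u x)]
    · have h1 : Tendsto (fun k : ℕ => βinf / ((k : ℝ) + 1)
          * (extBeta β βinf (u x) / βinf) ^ (k + 1)) atTop (𝓝 0) :=
        squeeze_zero (fun k => mul_nonneg (hnn k) (hpow x _).1)
          (fun k => mul_le_of_le_one_right (hnn k) (hpow x _).2) hto
      have h2 := (h1.const_sub (extBeta β βinf (u x))).const_mul (deriv ζ x)
      rwa [sub_zero] at h2
  refine tendsto_nhds_unique hleft (hright.neg.congr fun k => ?_)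
  exact (h.integral_comp_mul_flux hu hξ hlim (hasDerivAt_flattening hb k)
    (by fun_prop) hζ hζc).symm

/-- The limit flux is carried by the potential on the singular part. -/
theorem flux_ae_eq_of_singular (h : IsViscousFamily β βinf V Ve ρe ue ρ c)
    (hu : TendstoContinuously (fun ε x => ENNReal.ofReal (ue ε x)) (𝓝[>] 0) u)
    (hξ : MemLp ξ 2 (ρ : Measure ℝ))
    (hlim : ∀ φ : BoundedContinuousFunction ℝ ℝ,
        Tendsto (fun ε => ∫ x, φ x * viscousField β ε (Ve ε) (ue ε) x ∂(ρe ε : Measure ℝ))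
          (𝓝[>] 0) (𝓝 (∫ x, φ x * ξ x ∂(ρ : Measure ℝ)))) :
    ξ =ᵐ[(ρ : Measure ℝ).restrict (properDomain u)ᶜ] deriv V := by
  have hDm : MeasurableSet (properDomain u) := (isOpen_Iio.preimage hu.continuous).measurableSet
  have hξi : Integrable ξ (ρ : Measure ℝ) := hξ.integrable (by norm_num)
  refine ae_eq_of_integral_contDiff_smul_eq hξi.integrableOn.locallyIntegrable
    h.continuous_deriv.locallyIntegrable fun ζ hζ hζc => ?_
  obtain ⟨B, hB⟩ := hζc.exists_bound_of_continuous hζ.continuous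
  have j1 : Integrable (fun x => ζ x * ξ x) (ρ : Measure ℝ) :=
    integrable_bounded_mul hζ.continuous hB hξi
  have j2 : Integrable (fun x => ζ x * deriv V x) (ρ : Measure ℝ) :=
    (hζ.continuous.mul h.continuous_deriv).integrable_of_hasCompactSupport hζc.mul_right
  have i1 : Integrable (fun x => ζ x * (ξ x - deriv V x)) (ρ : Measure ℝ) := by
    refine (j1.sub j2).congr (Eventually.of_forall fun x => ?_)
    simp only [Pi.sub_apply]
    ring
  have h1 := h.setIntegral_flux hu hξ hlim hζ hζc
  have h2 := h.integral_comp_mul_flux hu hξ hlim (p := fun s => s) (p' := fun _ => 1)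
    (fun s => hasDerivAt_id s) continuous_const hζ hζc
  simp only [mul_one] at h2
  have h3 := integral_add_compl hDm i1
  -- The integral over the whole line and the one over the finite set equal the same distributional
  -- derivative.
  have h4 : ∫ x in (properDomain u)ᶜ, ζ x * (ξ x - deriv V x) ∂(ρ : Measure ℝ) = 0 := by
    linarith
  have h5 : ∫ x in (properDomain u)ᶜ, ζ x * (ξ x - deriv V x) ∂(ρ : Measure ℝ)
      = (∫ x in (properDomain u)ᶜ, ζ x * ξ x ∂(ρ : Measure ℝ))
        - ∫ x in (properDomain u)ᶜ, ζ x * deriv V x ∂(ρ : Measure ℝ) := by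
    rw [← integral_sub j1.integrableOn j2.integrableOn]
    exact integral_congr_ae (Eventually.of_forall fun x => by ring)
  simp only [smul_eq_mul]
  linarith

end IsViscousFamily

/-! ### Identification of the limit dissipation -/

section Density

variable {ρ : Measure ℝ} {u : ℝ → ℝ≥0∞}

theorem IsGenContDensity.ae_lt_top (hu : IsGenContDensity ρ u) : ∀ᵐ x, u x < ⊤ :=
  mem_ae_iff.2 hu.volume_compl

theorem IsGenContDensity.measurableSet_properDomain (hu : IsGenContDensity ρ u) :
    MeasurableSet (properDomain u) :=
  (isOpen_Iio.preimage hu.continuous).measurableSet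

theorem IsGenContDensity.setIntegral_eq (hu : IsGenContDensity ρ u)
    (hac : ρ.restrict (properDomain u) = volume.withDensity u) (f : ℝ → ℝ) :
    ∫ x in properDomain u, f x ∂ρ = ∫ x, f x * (u x).toReal := by
  rw [hac, integral_withDensity_eq_integral_toReal_smul hu.continuous.measurable hu.ae_lt_top]
  simp only [smul_eq_mul, mul_comm]

theorem IsGenContDensity.integrable_mul (hu : IsGenContDensity ρ u)
    (hac : ρ.restrict (properDomain u) = volume.withDensity u) {f : ℝ → ℝ}
    (hf : Integrable f ρ) : Integrable (fun x => f x * (u x).toReal) volume := by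
  have := hf.integrableOn (s := properDomain u)
  rwa [IntegrableOn, hac, integrable_withDensity_iff hu.continuous.measurable hu.ae_lt_top] at this

end Density

namespace IsViscousFamily

variable {β : ℝ → ℝ} {βinf : ℝ} {V : ℝ → ℝ} {Ve ue : ℝ → ℝ → ℝ} {ρe : ℝ → FiniteMeasure ℝ}
  {ρ : FiniteMeasure ℝ} {c : ℝ} {u : ℝ → ℝ≥0∞} {ξ : ℝ → ℝ}

/-- On the finite set `ρ` is `u ℒ¹`, so the restricted flux identity is already the weak
formulation. Local integrability comes from `ξ ∈ L¹(ρ)` and the continuity of `V'`. -/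
theorem isWeakDeriv_extBeta (h : IsViscousFamily β βinf V Ve ρe ue ρ c)
    (hgen : IsGenContDensity ρ u)
    (hac : (ρ : Measure ℝ).restrict (properDomain u) = volume.withDensity u)
    (hu : TendstoContinuously (fun ε x => ENNReal.ofReal (ue ε x)) (𝓝[>] 0) u)
    (hξ : MemLp ξ 2 (ρ : Measure ℝ))
    (hlim : ∀ φ : BoundedContinuousFunction ℝ ℝ,
        Tendsto (fun ε => ∫ x, φ x * viscousField β ε (Ve ε) (ue ε) x ∂(ρe ε : Measure ℝ))
          (𝓝[>] 0) (𝓝 (∫ x, φ x * ξ x ∂(ρ : Measure ℝ)))) :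
    IsWeakDeriv (fun x => extBeta β βinf (u x))
      (fun x => (ξ x - deriv V x) * (u x).toReal) := by
  refine ⟨(h.saturating.continuous_extBeta.comp hu.continuous).locallyIntegrable, ?_,
    fun ζ hζ hζc => ?_⟩
  · have h1 := (hgen.integrable_mul hac (hξ.integrable (by norm_num))).locallyIntegrable
    have h2 := (hgen.integrable_mul hac (integrable_const (1 : ℝ))).locallyIntegrable
    have h3 := h1.sub (h2.continuous_mul h.continuous_deriv)
    refine h3.congr (Eventually.of_forall fun x => ?_)
    simp only [Pi.sub_apply]
    ring
  · have h1 := h.setIntegral_flux hu hξ hlim hζ hζc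
    rw [hgen.setIntegral_eq hac] at h1
    simp only [mul_assoc] at h1
    linarith

/-- Dividing the weak derivative by `u` recovers `ξ - V'` where `0 < u < +∞`; points with `u = 0`
carry no weight; on the singular part `ξ = V'`. Lower semicontinuity thus reduces to the energy
bound for `ξ`. -/
theorem fisherIntegral_eq (h : IsViscousFamily β βinf V Ve ρe ue ρ c)
    (hgen : IsGenContDensity ρ u)
    (hsing : (ρ : Measure ℝ).singularPart volume = (ρ : Measure ℝ).restrict (properDomain u)ᶜ)
    (hac : (ρ : Measure ℝ).restrict (properDomain u) = volume.withDensity u)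
    (hu : TendstoContinuously (fun ε x => ENNReal.ofReal (ue ε x)) (𝓝[>] 0) u)
    (hξ : MemLp ξ 2 (ρ : Measure ℝ))
    (hlim : ∀ φ : BoundedContinuousFunction ℝ ℝ,
        Tendsto (fun ε => ∫ x, φ x * viscousField β ε (Ve ε) (ue ε) x ∂(ρe ε : Measure ℝ))
          (𝓝[>] 0) (𝓝 (∫ x, φ x * ξ x ∂(ρ : Measure ℝ)))) :
    fisherIntegral β βinf V ρ u = ENNReal.ofReal (∫ x, ξ x ^ 2 ∂(ρ : Measure ℝ)) := by
  have hDm := hgen.measurableSet_properDomain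
  have hPm : MeasurableSet (positiveDomain u) :=
    (isOpen_Ioo.preimage hgen.continuous).measurableSet
  rw [ofReal_integral_eq_lintegral_ofReal hξ.integrable_sq
    (Eventually.of_forall fun x => sq_nonneg _), ← lintegral_add_compl _ hDm, hac,
    fisherIntegral, hsing]
  congr 1
  · rw [lintegral_withDensity_eq_lintegral_mul_non_measurable _ hgen.continuous.measurable
      hgen.ae_lt_top, ← lintegral_indicator hPm]
    refine lintegral_congr_ae ?_
    filter_upwards [hgen.ae_lt_top,
      (h.isWeakDeriv_extBeta hgen hac hu hξ hlim).weakDeriv_ae_eq] with x hx hxw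
    by_cases h0 : 0 < u x
    · have hne : (u x).toReal ≠ 0 := (ENNReal.toReal_pos h0.ne' hx.ne).ne'
      rw [indicator_of_mem (show x ∈ positiveDomain u from ⟨h0, hx⟩), hxw,
        mul_div_cancel_right₀ _ hne, sub_add_cancel, Pi.mul_apply, mul_comm]
    · rw [indicator_of_notMem (fun hm : x ∈ positiveDomain u => h0 hm.1), Pi.mul_apply,
        not_lt.1 h0 |> le_antisymm <| zero_le, zero_mul]
  · refine lintegral_congr_ae ?_
    filter_upwards [h.flux_ae_eq_of_singular hu hξ hlim] with x hx
    rw [hx]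

end IsViscousFamily

/-! ### Second moments and nonlinear functions of the densities -/

/-- A lower semicontinuity property of the second moment under weak convergence. -/
theorem FiniteMeasure.lintegral_sq_le_liminf {ι : Type*} {l : Filter ι} [l.NeBot]
    {μs : ι → FiniteMeasure ℝ} {μ : FiniteMeasure ℝ} (hμ : Tendsto μs l (𝓝 μ)) :
    ∫⁻ x, ENNReal.ofReal (x ^ 2) ∂(μ : Measure ℝ)
      ≤ liminf (fun i => ∫⁻ x, ENNReal.ofReal (x ^ 2) ∂(μs i : Measure ℝ)) l := by
  -- The truncations `min (x²) n` are bounded and continuous and increase to `x²`; weak convergence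
  -- handles each one, monotone convergence the supremum.
  have hc : ∀ n : ℕ, Continuous fun x : ℝ => min (x ^ 2).toNNReal (n : ℝ≥0) := fun n => by fun_prop
  let g : ℕ → BoundedContinuousFunction ℝ ℝ≥0 := fun n =>
    BoundedContinuousFunction.mkOfBound ⟨_, hc n⟩ n fun x y => by
      rw [NNReal.dist_eq, abs_le]
      have h1 : ∀ z : ℝ, ((min (z ^ 2).toNNReal (n : ℝ≥0) : ℝ≥0) : ℝ) ≤ n := fun z => by
        exact_mod_cast min_le_right _ _
      have h2 : ∀ z : ℝ, 0 ≤ ((min (z ^ 2).toNNReal (n : ℝ≥0) : ℝ≥0) : ℝ) :=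
        fun z => NNReal.coe_nonneg _
      have hx := h1 x
      have hy := h1 y
      have hx' := h2 x
      have hy' := h2 y
      constructor
      · change -(n : ℝ) ≤ ((min (x ^ 2).toNNReal (n : ℝ≥0) : ℝ≥0) : ℝ)
          - ((min (y ^ 2).toNNReal (n : ℝ≥0) : ℝ≥0) : ℝ)
        linarith
      · change ((min (x ^ 2).toNNReal (n : ℝ≥0) : ℝ≥0) : ℝ)
          - ((min (y ^ 2).toNNReal (n : ℝ≥0) : ℝ≥0) : ℝ) ≤ n
        linarith
  have hg : ∀ n x, g n x = min (x ^ 2).toNNReal (n : ℝ≥0) := fun n x => rfl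
  have hle : ∀ n, ∫⁻ x, (g n x : ℝ≥0∞) ∂(μ : Measure ℝ)
      ≤ liminf (fun i => ∫⁻ x, ENNReal.ofReal (x ^ 2) ∂(μs i : Measure ℝ)) l := fun n => by
    rw [← (FiniteMeasure.tendsto_iff_forall_lintegral_tendsto.1 hμ (g n)).liminf_eq]
    refine liminf_le_liminf (Eventually.of_forall fun i => lintegral_mono fun x => ?_)
    rw [hg]
    exact ENNReal.coe_le_coe.2 (min_le_left _ _)
  refine le_of_tendsto' (lintegral_tendsto_of_tendsto_of_monotone
    (fun n => (ENNReal.continuous_coe.comp (g n).continuous).aemeasurable)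
    (Eventually.of_forall fun x n k hnk => ?_) (Eventually.of_forall fun x => ?_)) hle
  · simp only [Function.comp_apply, hg]
    exact ENNReal.coe_le_coe.2 (min_le_min_left _ (by exact_mod_cast hnk))
  · refine tendsto_const_nhds.congr' ?_
    filter_upwards [eventually_ge_atTop ⌈(x ^ 2).toNNReal⌉₊] with n hn
    simp only [Function.comp_apply, hg]
    rw [min_eq_left ((Nat.le_ceil _).trans (by exact_mod_cast hn))]
    rfl

/-- A function with sublinear growth is small compared with the identity at infinity. -/
theorem exists_forall_abs_sub_le_mul {f : ℝ → ℝ} {a : ℝ}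
    (hf : Tendsto (fun r => f r / r) atTop (𝓝 a)) {η : ℝ} (hη : 0 < η) :
    ∃ R > 0, ∀ r, R ≤ r → |f r - a * r| ≤ η * r := by
  obtain ⟨R, hR⟩ := (hf.eventually (Metric.ball_mem_nhds _ hη)).exists_forall_of_atTop
  refine ⟨max R 1, by positivity, fun r hr => ?_⟩
  have h0 : 0 < r := one_pos.trans_le ((le_max_right _ _).trans hr)
  have h1 : |f r / r - a| < η := hR r ((le_max_left _ _).trans hr)
  have h2 : f r - a * r = (f r / r - a) * r := by field_simp
  rw [h2, abs_mul, abs_of_pos h0]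
  exact mul_le_mul_of_nonneg_right h1.le h0.le

namespace IsViscousFamily

variable {β : ℝ → ℝ} {βinf : ℝ} {V : ℝ → ℝ} {Ve ue : ℝ → ℝ → ℝ} {ρe : ℝ → FiniteMeasure ℝ}
  {ρ : FiniteMeasure ℝ} {c : ℝ} {u : ℝ → ℝ≥0∞}

/-- Convergence of sublinear functions of the densities. -/
theorem tendsto_integral_sublinear (h : IsViscousFamily β βinf V Ve ρe ue ρ c)
    (hgen : IsGenContDensity ρ u)
    (hac : (ρ : Measure ℝ).restrict (properDomain u) = volume.withDensity u)
    (hu : TendstoContinuously (fun ε x => ENNReal.ofReal (ue ε x)) (𝓝[>] 0) u)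
    {g : ℝ → ℝ} (hg : Continuous g)
    (hsub : ∀ η > 0, ∃ R > 0, ∀ r, R ≤ r → |g r| ≤ η * r)
    (hgi : LocallyIntegrable (fun x => g (u x).toReal) volume)
    (hgi' : ∀ ε > 0, LocallyIntegrable (fun x => g (ue ε x)) volume)
    {φ : ℝ → ℝ} (hφ : Continuous φ) (hφc : HasCompactSupport φ) :
    Tendsto (fun ε => ∫ x, φ x * g (ue ε x)) (𝓝[>] 0) (𝓝 (∫ x, φ x * g (u x).toReal)) := by
  obtain ⟨B, hB⟩ := hφc.exists_bound_of_continuous hφ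
  have hB0 : 0 ≤ B := (norm_nonneg _).trans (hB 0)
  have hui : Integrable (fun x => (u x).toReal) volume := by
    simpa using hgen.integrable_mul hac (integrable_const (1 : ℝ))
  have hum : ∫ x, (u x).toReal ≤ ρ.mass + 1 := by
    have h1 := hgen.setIntegral_eq hac fun _ => 1
    simp only [one_mul] at h1
    rw [← h1]
    have h2 : (ρ : Measure ℝ).real (properDomain u) ≤ (ρ : Measure ℝ).real univ :=
      measureReal_mono (subset_univ _)
    have h3 : (ρ : Measure ℝ).real univ = ρ.mass := rfl
    simp only [integral_const, smul_eq_mul, mul_one, measureReal_restrict_apply_univ]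
    linarith
  have hm : (0 : ℝ) ≤ ρ.mass := NNReal.coe_nonneg _
  rw [Metric.tendsto_nhds]
  intro κ hκ
  -- Chosen so that the truncation error `2η · B · (ρ.mass + 1)` is at most `κ / 4`, both for the
  -- limit and along the family.
  set η := κ / (8 * ((B + 1) * (ρ.mass + 1))) with hη
  have hη0 : 0 < η := by positivity
  obtain ⟨R, hR0, hR⟩ := hsub η hη0
  -- Freezing `g` beyond `R` makes it continuous on all of `[0,+∞]`, so that the convergence of the
  -- extended densities applies.
  set G : ℝ≥0∞ → ℝ := fun r => g (min r (ENNReal.ofReal R)).toReal with hG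
  have hGc : Continuous G := by
    refine hg.comp (ENNReal.continuousOn_toReal.comp_continuous (by fun_prop) fun r => ?_)
    exact ((min_le_right _ _).trans_lt ENNReal.ofReal_lt_top).ne
  have hGr : ∀ r : ℝ≥0∞, r ≠ ⊤ → |g r.toReal - G r| ≤ 2 * η * r.toReal := fun r hr => by
    rcases le_total r (ENNReal.ofReal R) with h1 | h1
    · simp only [hG, min_eq_left h1, sub_self, abs_zero]
      have : 0 ≤ r.toReal := ENNReal.toReal_nonneg
      positivity
    · have h2 : R ≤ r.toReal := (ENNReal.ofReal_le_iff_le_toReal hr).1 h1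
      simp only [hG, min_eq_right h1, ENNReal.toReal_ofReal hR0.le]
      have h3 := hR _ h2
      have h4 := hR R le_rfl
      have h5 : η * R ≤ η * r.toReal := by gcongr
      calc _ ≤ |g r.toReal| + |g R| := abs_sub _ _
        _ ≤ 2 * η * r.toReal := by linarith
  have hest : ∀ v : ℝ → ℝ≥0∞, Continuous v → (∀ᵐ x, v x ≠ ⊤) →
      LocallyIntegrable (fun x => g (v x).toReal) volume →
      Integrable (fun x => (v x).toReal) volume → ∫ x, (v x).toReal ≤ ρ.mass + 1 →
      |(∫ x, φ x * g (v x).toReal) - ∫ x, φ x * G (v x)| ≤ κ / 4 := by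
    intro v hv hvt hvg hvi hvm
    have i1 : Integrable (fun x => φ x * g (v x).toReal) volume :=
      hvg.integrable_smul_left_of_hasCompactSupport hφ hφc
    have i2 : Integrable (fun x => φ x * G (v x)) volume :=
      (hφ.mul (hGc.comp hv)).integrable_of_hasCompactSupport hφc.mul_right
    rw [← integral_sub i1 i2, ← Real.norm_eq_abs]
    calc ‖∫ x, φ x * g (v x).toReal - φ x * G (v x)‖ ≤ ∫ x, B * (2 * η) * (v x).toReal := by
          refine norm_integral_le_of_norm_le (hvi.const_mul _) (hvt.mono fun x hx => ?_)
          rw [← mul_sub, norm_mul, mul_assoc]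
          exact mul_le_mul (hB x) (hGr _ hx) (norm_nonneg _) hB0
      _ = B * (2 * η) * ∫ x, (v x).toReal := integral_const_mul _ _
      _ ≤ (B + 1) * (2 * η) * (ρ.mass + 1) := by
          gcongr
          linarith
      _ = κ / 4 := by
          rw [hη]
          field_simp
          norm_num
  have hlim := (hu.comp_continuous hGc).tendsto_integral_volume (h.eventually_continuous hGc) hφ hφc
  filter_upwards [eventually_pos, h.eventually_mass_le,
    hlim.eventually (Metric.ball_mem_nhds _ (by positivity : 0 < κ / 4))] with ε hε hme hlε
  have hst := h.state ε hε
  have htr : ∀ x, (ENNReal.ofReal (ue ε x)).toReal = ue ε x := fun x =>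
    ENNReal.toReal_ofReal (hst.pos x).le
  have e1 := hest u hgen.continuous (hgen.ae_lt_top.mono fun x hx => hx.ne) hgi hui hum
  have e2 := hest (fun x => ENNReal.ofReal (ue ε x))
    (ENNReal.continuous_ofReal.comp hst.continuous)
    (Eventually.of_forall fun x => ENNReal.ofReal_ne_top)
    (by simpa only [htr] using hgi' ε hε)
    (by simpa only [htr] using h.integrable_density hε)
    (by
      simp only [htr]
      have := hst.integral_eq fun _ => 1
      simp only [integral_const, smul_eq_mul, mul_one, one_mul] at this
      rwa [← this])
  simp only [htr] at e2
  have e3 : |(∫ x, φ x * G (ENNReal.ofReal (ue ε x))) - ∫ x, φ x * G (u x)| < κ / 4 := hlε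
  rw [Real.dist_eq]
  rw [abs_le] at e1 e2
  rw [abs_lt] at e3 ⊢
  constructor <;> linarith [e1.1, e1.2, e2.1, e2.2, e3.1, e3.2]

/-- Convergence of asymptotically linear functions of the densities. -/
theorem tendsto_integral_asymptotically_linear (h : IsViscousFamily β βinf V Ve ρe ue ρ c)
    (hgen : IsGenContDensity ρ u)
    (hsing : (ρ : Measure ℝ).singularPart volume = (ρ : Measure ℝ).restrict (properDomain u)ᶜ)
    (hac : (ρ : Measure ℝ).restrict (properDomain u) = volume.withDensity u)
    (hu : TendstoContinuously (fun ε x => ENNReal.ofReal (ue ε x)) (𝓝[>] 0) u)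
    {f : ℝ → ℝ} {a : ℝ} (hf : ContinuousOn f (Ici 0))
    (hfa : Tendsto (fun r => f r / r) atTop (𝓝 a)) :
    LocallyIntegrable (fun x => f (u x).toReal) volume ∧
      ∀ φ : ℝ → ℝ, Continuous φ → HasCompactSupport φ →
        Tendsto (fun ε => ∫ x, φ x * f (ue ε x)) (𝓝[>] 0)
          (𝓝 ((∫ x, φ x * f (u x).toReal)
            + a * ∫ x, φ x ∂((ρ : Measure ℝ).singularPart volume))) := by
  -- Removing the asymptote leaves a sublinear remainder, which does not see the concentrated mass;
  -- `max r 0` is needed because `f` is continuous only on `[0,+∞)`.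
  set g : ℝ → ℝ := fun r => f (max r 0) - a * r with hg
  have hgc : Continuous g :=
    (hf.comp_continuous (continuous_id.max continuous_const) fun r =>
      mem_Ici.2 (le_max_right r 0)).sub (continuous_const.mul continuous_id)
  have hfg : ∀ r, 0 ≤ r → f r = g r + a * r := fun r hr => by
    simp only [hg, max_eq_left hr]
    ring
  have hsub : ∀ η > 0, ∃ R > 0, ∀ r, R ≤ r → |g r| ≤ η * r := fun η hη => by
    obtain ⟨R, hR0, hR⟩ := exists_forall_abs_sub_le_mul hfa hη
    refine ⟨R, hR0, fun r hr => ?_⟩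
    simp only [hg, max_eq_left (hR0.le.trans hr)]
    exact hR r hr
  have hui : Integrable (fun x => (u x).toReal) volume := by
    simpa using hgen.integrable_mul hac (integrable_const (1 : ℝ))
  have hgi : LocallyIntegrable (fun x => g (u x).toReal) volume := by
    obtain ⟨R, hR0, hR⟩ := hsub 1 one_pos
    obtain ⟨C, hC⟩ := (isCompact_Icc (a := (0 : ℝ)) (b := R)).exists_bound_of_continuousOn
      hgc.continuousOn
    have hC0 : 0 ≤ C := (norm_nonneg _).trans (hC 0 ⟨le_rfl, hR0.le⟩)
    refine ((continuous_const (y := C)).locallyIntegrable.add hui.locallyIntegrable).mono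
      (hgc.measurable.comp hgen.continuous.measurable.ennreal_toReal).aestronglyMeasurable
      (Eventually.of_forall fun x => ?_)
    have h0 : 0 ≤ (u x).toReal := ENNReal.toReal_nonneg
    simp only [Pi.add_apply]
    rw [Real.norm_of_nonneg (add_nonneg hC0 h0)]
    rcases le_total (u x).toReal R with h1 | h1
    · exact (hC _ ⟨h0, h1⟩).trans (by linarith)
    · have := hR _ h1
      rw [Real.norm_eq_abs]
      linarith
  have hfu : ∀ x, f (u x).toReal = g (u x).toReal + a * (u x).toReal := fun x =>
    hfg _ ENNReal.toReal_nonneg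
  refine ⟨(hgi.add (hui.const_mul a).locallyIntegrable).congr
    (Eventually.of_forall fun x => (hfu x).symm), fun φ hφ hφc => ?_⟩
  have hgi' : ∀ ε > 0, LocallyIntegrable (fun x => g (ue ε x)) volume := fun ε hε =>
    (hgc.comp (h.state ε hε).continuous).locallyIntegrable
  have h1 := h.tendsto_integral_sublinear hgen hac hu hgc hsub hgi hgi' hφ hφc
  obtain ⟨B, hB⟩ := hφc.exists_bound_of_continuous hφ
  have h2 := (FiniteMeasure.tendsto_iff_forall_integral_tendsto.1 h.tendsto
    (BoundedContinuousFunction.ofNormedAddCommGroup φ hφ B hB)).const_mul a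
  -- The linear part converges to all of `ρ`; its splitting is the source of the singular term in
  -- the limit.
  have h3 : ∫ x, φ x ∂(ρ : Measure ℝ) = (∫ x, φ x * (u x).toReal)
      + ∫ x, φ x ∂((ρ : Measure ℝ).singularPart volume) := by
    rw [hsing, ← hgen.setIntegral_eq hac, integral_add_compl hgen.measurableSet_properDomain
      (hφ.integrable_of_hasCompactSupport hφc)]
  have i1 : Integrable (fun x => φ x * g (u x).toReal) volume :=
    hgi.integrable_smul_left_of_hasCompactSupport hφ hφc
  have i2 : Integrable (fun x => a * (φ x * (u x).toReal)) volume :=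
    (integrable_bounded_mul hφ hB hui).const_mul a
  have h4 : (∫ x, φ x * f (u x).toReal)
        + a * ∫ x, φ x ∂((ρ : Measure ℝ).singularPart volume)
      = (∫ x, φ x * g (u x).toReal) + a * ∫ x, φ x ∂(ρ : Measure ℝ) := by
    have h5 : ∫ x, φ x * f (u x).toReal
        = (∫ x, φ x * g (u x).toReal) + a * ∫ x, φ x * (u x).toReal := by
      rw [← integral_const_mul, ← integral_add i1 i2]
      refine integral_congr_ae (Eventually.of_forall fun x => ?_)
      simp only [hfu]
      ring
    rw [h5, h3]
    ring
  rw [h4]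
  refine (h1.add h2).congr' ?_
  filter_upwards [eventually_pos] with ε hε
  have hst := h.state ε hε
  have j1 : Integrable (fun x => φ x * g (ue ε x)) volume :=
    (hgi' ε hε).integrable_smul_left_of_hasCompactSupport hφ hφc
  have j2 : Integrable (fun x => a * (φ x * ue ε x)) volume :=
    (integrable_bounded_mul hφ hB (h.integrable_density hε)).const_mul a
  change (∫ x, φ x * g (ue ε x)) + a * (∫ x, φ x ∂(ρe ε : Measure ℝ)) = _
  rw [hst.integral_eq, ← integral_const_mul, ← integral_add j1 j2]
  refine integral_congr_ae (Eventually.of_forall fun x => ?_)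
  simp only [hfg _ (hst.pos x).le]
  ring

/-- Convergence in `[0,+∞]` becomes convergence of real numbers at points where the limit is finite.
-/
theorem tendstoUniformlyOn_density (h : IsViscousFamily β βinf V Ve ρe ue ρ c)
    (hu : TendstoContinuously (fun ε x => ENNReal.ofReal (ue ε x)) (𝓝[>] 0) u)
    {K : Set ℝ} (hK : IsCompact K) (hKu : K ⊆ properDomain u) :
    TendstoUniformlyOn ue (fun x => (u x).toReal) (𝓝[>] 0) K := by
  refine tendstoUniformlyOn_of_tendsto_prod hK
    (fun x hx => (ENNReal.tendsto_toReal (ne_of_lt (hKu hx))).comp hu.continuous.continuousAt)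
    fun x hx => ?_
  refine ((ENNReal.tendsto_toReal (ne_of_lt (hKu hx))).comp (hu x)).congr' ?_
  filter_upwards [eventually_pos.prod_inl (𝓝 x)] with q hq
  exact ENNReal.toReal_ofReal ((h.state q.1 hq).pos q.2).le

end IsViscousFamily

/-! ### The convergence theorem -/

theorem theorem3p3
    -- the nonlinearity
    (β : ℝ → ℝ) (βinf : ℝ)
    (hβ_diff : ContDiffOn ℝ 1 β (Ici 0)) (hβ_mono : StrictMonoOn β (Ici 0))
    (hβ_zero : β 0 = 0) (hβ_lim : Tendsto β atTop (𝓝 βinf))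
    -- the potentials
    (V : ℝ → ℝ) (hV : ContDiff ℝ 1 V)
    (Ve : ℝ → ℝ → ℝ) (hVe : ∀ ε > 0, ContDiff ℝ 1 (Ve ε))
    (hVe_lim : ∀ K : Set ℝ, IsCompact K →
      TendstoUniformlyOn (fun ε => deriv (Ve ε)) (deriv V) (𝓝[>] 0) K)
    -- the measures, with their continuous positive densities
    (m : ℝ≥0) (hm : 0 < m)
    (ρe : ℝ → FiniteMeasure ℝ) (ue : ℝ → ℝ → ℝ)
    (hmass : ∀ ε > 0, (ρe ε).mass = m)
    (hue_cont : ∀ ε > 0, Continuous (ue ε))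
    (hue_pos : ∀ ε > 0, ∀ x, 0 < ue ε x)
    (hρe : ∀ ε > 0, (ρe ε : Measure ℝ) = volume.withDensity (fun x => ENNReal.ofReal (ue ε x)))
    (hI : ∀ ε > 0, viscousFisher β ε (Ve ε) (ρe ε) < ⊤)
    -- weak convergence and bounded dissipation
    (ρ : FiniteMeasure ℝ) (hρ : Tendsto ρe (𝓝[>] 0) (𝓝 ρ))
    (hI_bdd : limsup (fun ε => viscousFisher β ε (Ve ε) (ρe ε)) (𝓝[>] 0) < ⊤) :
    ∃ u : ℝ → ℝ≥0∞, IsGenContDensity ρ u ∧ ρ.mass = m ∧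
      MemW11loc (fun x => extBeta β βinf (u x)) ∧
      genFisher β βinf V ρ < ⊤ ∧
      genFisher β βinf V ρ ≤ liminf (fun ε => viscousFisher β ε (Ve ε) (ρe ε)) (𝓝[>] 0) ∧
      -- finiteness of the quadratic moment passes to the limit
      (liminf (fun ε => ∫⁻ x, ENNReal.ofReal (x ^ 2) ∂(ρe ε : Measure ℝ)) (𝓝[>] 0) < ⊤ →
        ∫⁻ x, ENNReal.ofReal (x ^ 2) ∂(ρ : Measure ℝ) < ⊤) ∧
      -- locally uniform convergence of the densities where `u` is finite
      (∀ K : Set ℝ, IsCompact K → K ⊆ properDomain u →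
        TendstoUniformlyOn ue (fun x => (u x).toReal) (𝓝[>] 0) K) ∧
      -- convergence of the fluxes against bounded continuous functions
      (∃ ξ : ℝ → ℝ, MemLp ξ 2 (ρ : Measure ℝ) ∧
        (∀ φ : ℝ → ℝ, Continuous φ → HasCompactSupport φ →
          ∫ x, φ x * ξ x ∂(ρ : Measure ℝ) =
            (∫ x, φ x * weakDeriv (fun y => extBeta β βinf (u y)) x)
              + ∫ x, φ x * deriv V x ∂(ρ : Measure ℝ)) ∧
        (∀ φ : ℝ → ℝ, Continuous φ → (∃ C, ∀ x, |φ x| ≤ C) →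
          Tendsto (fun ε => ∫ x, φ x * viscousField β ε (Ve ε) (ue ε) x ∂(ρe ε : Measure ℝ))
            (𝓝[>] 0) (𝓝 (∫ x, φ x * ξ x ∂(ρ : Measure ℝ))))) ∧
      -- convergence of asymptotically linear functions of the densities
      (∀ (f : ℝ → ℝ) (finf : ℝ), ContinuousOn f (Ici 0) →
        Tendsto (fun r => f r / r) atTop (𝓝 finf) →
        LocallyIntegrable (fun x => f (u x).toReal) volume ∧
        ∀ φ : ℝ → ℝ, Continuous φ → HasCompactSupport φ →
          Tendsto (fun ε => ∫ x, φ x * f (ue ε x)) (𝓝[>] 0)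
            (𝓝 ((∫ x, φ x * f (u x).toReal)
              + finf * ∫ x, φ x ∂((ρ : Measure ℝ).singularPart volume)))) := by
  have hβ_at : ∀ r, 0 < r → ContDiffAt ℝ 1 β r := fun r hr => hβ_diff.contDiffAt (Ici_mem_nhds hr)
  have hder : ∀ r, 0 < r → HasDerivAt β (deriv β r) r := fun r hr =>
    ((hβ_at r hr).differentiableAt (by norm_num)).hasDerivAt
  have hder_nonneg : ∀ r, 0 < r → 0 ≤ deriv β r := fun r hr => by
    rw [← derivWithin_of_mem_nhds (Ici_mem_nhds hr)]
    exact hβ_mono.monotoneOn.derivWithin_nonneg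
  have hder_cont : ContinuousOn (deriv β) (Ioi 0) :=
    (hβ_diff.mono Ioi_subset_Ici_self).continuousOn_deriv_of_isOpen isOpen_Ioi le_rfl
  -- Any finite number above the limsup bounds the dissipation for all small `ε`.
  obtain ⟨b, hb1, hb2⟩ := exists_between hI_bdd
  have h : IsViscousFamily β βinf V Ve ρe ue ρ b.toReal :=
    { saturating := ⟨hβ_diff.continuousOn, hβ_mono, hβ_zero, hβ_lim⟩
      state := fun ε hε => ⟨hder, hder_nonneg, hder_cont, hε, (hVe ε hε).continuous_deriv le_rfl,
        hue_cont ε hε, hue_pos ε hε, hρe ε hε, hI ε hε⟩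
      continuous_deriv := hV.continuous_deriv le_rfl
      tendsto_deriv := hVe_lim
      tendsto := hρ
      fisher_le := (eventually_lt_of_limsup_lt hb1).mono fun ε hε => by
        rw [ENNReal.ofReal_toReal hb2.ne]
        exact hε.le
      bound_nonneg := ENNReal.toReal_nonneg }
  obtain ⟨u, hgen, hsing, hac, hu⟩ := h.exists_density
  obtain ⟨ξ, hξ, hξle, hlim⟩ := h.exists_flux hu
  have hwd := h.isWeakDeriv_extBeta hgen hac hu hξ hlim
  have hmem : MemW11loc (fun x => extBeta β βinf (u x)) := ⟨_, hwd⟩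
  have hgf : genFisher β βinf V ρ = ENNReal.ofReal (∫ x, ξ x ^ 2 ∂(ρ : Measure ℝ)) :=
    (genFisher_eq β βinf V hgen hmem).trans
      (h.fisherIntegral_eq hgen hsing hac hu hξ hlim)
  refine ⟨u, hgen, ?_, hmem, ?_, ?_, fun h2 => ?_, fun K hK hKu => ?_, ⟨ξ, hξ, ?_, ?_⟩, ?_⟩
  · refine tendsto_nhds_unique ((FiniteMeasure.continuous_mass.tendsto ρ).comp hρ)
      (tendsto_const_nhds.congr' ?_)
    filter_upwards [self_mem_nhdsWithin] with ε hε
    exact (hmass ε hε).symm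
  · rw [hgf]
    exact ENNReal.ofReal_lt_top
  · rw [hgf]
    exact hξle
  · exact (FiniteMeasure.lintegral_sq_le_liminf hρ).trans_lt h2
  · exact h.tendstoUniformlyOn_density hu hK hKu
  · intro φ hφ hφc
    obtain ⟨B, hB⟩ := hφc.exists_bound_of_continuous hφ
    have i1 : Integrable (fun x => φ x * ξ x) (ρ : Measure ℝ) :=
      integrable_bounded_mul hφ hB (hξ.integrable (by norm_num))
    have i2 : Integrable (fun x => φ x * deriv V x) (ρ : Measure ℝ) :=
      (hφ.mul h.continuous_deriv).integrable_of_hasCompactSupport hφc.mul_right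
    -- The flux identity for merely continuous `φ` follows from the pointwise formulas: `∂ₓβ(u) = (ξ
    -- - V')u` almost everywhere, and `ξ = V'` on the singular part.
    have e1 : ∫ x, φ x * weakDeriv (fun y => extBeta β βinf (u y)) x
        = ∫ x in properDomain u, φ x * ξ x - φ x * deriv V x ∂(ρ : Measure ℝ) := by
      rw [hgen.setIntegral_eq hac]
      refine integral_congr_ae (hwd.weakDeriv_ae_eq.mono fun x hx => ?_)
      simp only [hx]
      ring
    have e2 : ∫ x in (properDomain u)ᶜ, φ x * ξ x - φ x * deriv V x ∂(ρ : Measure ℝ) = 0 := by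
      refine integral_eq_zero_of_ae ?_
      filter_upwards [h.flux_ae_eq_of_singular hu hξ hlim] with x hx
      simp only [hx, sub_self, Pi.zero_apply]
    have e3 := integral_add_compl hgen.measurableSet_properDomain (i1.sub i2)
    simp only [Pi.sub_apply] at e3
    rw [integral_sub i1 i2] at e3
    rw [e1]
    linarith
  · rintro φ hφ ⟨C, hC⟩
    exact hlim (BoundedContinuousFunction.ofNormedAddCommGroup φ hφ C hC)
  · intro f finf hf hfinf
    exact h.tendsto_integral_asymptotically_linear hgen hsing hac hu hf hfinf
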